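/- Let $\lambda>0$ and $\delta\in[0,1)$, and consider the TCP process on $\mathbb R_+=[0,\infty)$ with constant jump rate $\lambda$ and deterministic contraction factor $\delta$, i.e. the piecewise deterministic Markov process with generator $$Lf(x)=f'(x)+\lambda\bigl(f(\delta x)-f(x)\bigr):$$ the process grows at unit speed between jumps, the times between successive jumps are independent exponential variables with parameter $\lambda$, and at each jump the current position $x$ is replaced by $\delta x$. Let $P_tf(x)=\mathbb E(f(X_t)\mid X_0=x)$ be its semigroup, let $\mu$ be its invariant law (a probability measure on $[0,\infty)$ such that $\mu P_t=\mu$ for all $t\ge 0$), write $\mu g=\int g\,d\mu$, and let $\mathcal A$ be the set of $C^\infty$ functions on $[0,\infty)$ all of whose derivatives (including the function itself) grow at most polynomially at infinity. Then, for every $f\in\mathcal A$, the functions $f$ and $f'$ belong to $L^2(\mu)$, and $$\mu\bigl((f-\mu f)^2\bigr)\le\frac{4}{\lambda^2(1-\delta^2)}\,\mu\bigl((f')^2\bigr).$$ Moreover, for every $f\in\mathcal A$ and every $t\ge 0$, $P_tf(x)$ is well defined (the expectation converges absolutely) for all $x\ge0$, $P_tf\in L^2(\mu)$, and $$\mu\bigl((P_tf-\mu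 f)^2\bigr)\le\frac{4\,e^{-\lambda(1-\delta^2)t}}{\lambda^2(1-\delta^2)}\,\mu\bigl((f')^2\bigr).$$ -/

import Mathlib

open MeasureTheory Set

namespace TCP

/-- The law of the sequence `(T₀, T₁, …)` of inter-jump times: independent exponential variables
with parameter `lam`. -/
noncomputable def clockLaw (lam : ℝ) : Measure (ℕ → ℝ) :=
  Measure.infinitePi (fun _ : ℕ => ProbabilityTheory.expMeasure lam)

/-- The jump times: `S₀ = 0` and `S_{k+1} = S_k + T_k`. -/
noncomputable def jumpTime (ω : ℕ → ℝ) (k : ℕ) : ℝ := ∑ i ∈ Finset.range k, ω i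

/-- The embedded chain: `Z₀ = x`, and `Z_{k+1} = δ (Z_k + T_k)`, since between two jumps the process
follows the flow `x ↦ x + t` of the vector field `b = 1`, and a jump multiplies it by `δ`. -/
noncomputable def embeddedChain (δ x : ℝ) (ω : ℕ → ℝ) : ℕ → ℝ
  | 0 => x
  | k + 1 => δ * (embeddedChain δ x ω k + ω k)

/-- The number of jumps up to time `t`, i.e. the (almost surely unique) index `k` such that
`S_k ≤ t < S_{k+1}`. -/
noncomputable def jumpCount (ω : ℕ → ℝ) (t : ℝ) : ℕ := sInf {k : ℕ | t < jumpTime ω (k + 1)}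

/-- The TCP process started from `x`, with constant jump rate and contraction factor `δ`:
`X_t = Z_k + (t - S_k)` for `t ∈ [S_k, S_{k+1})`. Under `clockLaw lam`, this is the piecewise
deterministic Markov process with generator `L f (x) = f' x + lam * (f (δ * x) - f x)`. -/
noncomputable def process (δ x t : ℝ) (ω : ℕ → ℝ) : ℝ :=
  embeddedChain δ x ω (jumpCount ω t) + (t - jumpTime ω (jumpCount ω t))

/-- The semigroup `P_t f (x) = 𝔼 [f (X_t) | X_0 = x]`. -/
noncomputable def semigroup (lam δ t : ℝ) (f : ℝ → ℝ) (x : ℝ) : ℝ :=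
  ∫ ω, f (process δ x t ω) ∂(clockLaw lam)

/-- `μ` is an invariant law of the process on `[0, ∞)`: a probability measure carried by `[0, ∞)`
such that if `X_0` has law `μ`, then `X_t` has law `μ` for all `t ≥ 0`. -/
structure IsInvariantLaw (lam δ : ℝ) (μ : Measure ℝ) : Prop where
  isProbabilityMeasure : IsProbabilityMeasure μ
  support : μ (Iio 0) = 0
  invariant : ∀ t : ℝ, 0 ≤ t → ∀ B : Set ℝ, MeasurableSet B →
    ∫⁻ x, clockLaw lam {ω | process δ x t ω ∈ B} ∂μ = μ B

/-- The class of test functions: smooth functions on `[0, ∞)` all of whose derivatives grow at most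
polynomially at infinity. The values of `f` on the negative half-line are irrelevant. -/
def IsTestFunction (f : ℝ → ℝ) : Prop :=
  ContDiffOn ℝ (⊤ : ℕ∞) f (Ici 0) ∧
    ∀ n : ℕ, ∃ (C : ℝ) (k : ℕ), ∀ x ∈ Ici (0 : ℝ),
      |iteratedDerivWithin n f (Ici 0) x| ≤ C * (1 + x) ^ k

end TCP

namespace TCP

open ProbabilityTheory Filter Topology

/-! The invariant law is that of a perpetuity: it is preserved by `X ↦ δ X + E`, with `E`
exponential and independent of `X`. This equation carries the Poincaré inequality. Given `X`,
Hardy's inequality (`hardy_expMeasure`) bounds the fluctuation of `g (δ X + E)` around `g (δ X)` by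
`4 / lam ^ 2` times the conditional mean of `g' ^ 2`. What remains is the variance of `T g (x) = 𝔼
[g (δ x + E)]`, and `μ ((T g)' ^ 2) ≤ δ ^ 2 μ (g' ^ 2)` by Cauchy-Schwarz and stationarity.
Iteration sums a geometric series of ratio `δ ^ 2` (`poincare_of_isStationary`).

The fixed-point equation is read off invariance over short times. Testing it on characters, which
are bounded and so need no moments, gives `φ θ (lam - i θ) = lam φ (δ θ)` for the characteristic
function `φ` of `μ` (`charFun_mul_eq`). The moments of `μ` then follow from the equation itself
(`IsStationary.hasMoments`).

For the decay, given the clocks, `X_t` is affine in its starting point with slope `δ ^ N_t`, `N_t`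
being the number of jumps. Hence `μ ((P_t f)' ^ 2) ≤ 𝔼 [δ ^ (2 N_t)] μ (f' ^ 2)`, where the
expectation is at most `exp (-lam (1 - δ ^ 2) t)` (`integral_pow_jumpCount_le`). The Poincaré
inequality applied to `P_t f` concludes. -/

/-! ### Polynomial growth and moments. -/

/-- A function on `ℝ` growing at most polynomially. -/
def PolyBounded (g : ℝ → ℝ) : Prop := ∃ (C : ℝ) (k : ℕ), 0 ≤ C ∧ ∀ x, |g x| ≤ C * (1 + |x|) ^ k

/-- A measure on `ℝ` all of whose moments are finite. -/
def HasMoments (ν : Measure ℝ) : Prop := ∀ k : ℕ, Integrable (fun x => (1 + |x|) ^ k) ν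

lemma one_le_one_add_abs (x : ℝ) : 1 ≤ 1 + |x| := by linarith [abs_nonneg x]

lemma PolyBounded.mul {g h : ℝ → ℝ} (hg : PolyBounded g) (hh : PolyBounded h) :
    PolyBounded (fun x => g x * h x) := by
  obtain ⟨C, k, hC, hg⟩ := hg
  obtain ⟨D, l, hD, hh⟩ := hh
  refine ⟨C * D, k + l, by positivity, fun x => ?_⟩
  rw [abs_mul, pow_add]
  calc |g x| * |h x| ≤ (C * (1 + |x|) ^ k) * (D * (1 + |x|) ^ l) :=
        mul_le_mul (hg x) (hh x) (abs_nonneg _) (by positivity)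
    _ = _ := by ring

lemma PolyBounded.sq {g : ℝ → ℝ} (hg : PolyBounded g) : PolyBounded (fun x => g x ^ 2) := by
  simpa only [pow_two] using hg.mul hg

lemma PolyBounded.sub_const {g : ℝ → ℝ} (hg : PolyBounded g) (c : ℝ) :
    PolyBounded (fun x => g x - c) := by
  obtain ⟨C, k, hC, hg⟩ := hg
  refine ⟨C + |c|, k, by positivity, fun x => ?_⟩
  have h1 : 1 ≤ (1 + |x|) ^ k := one_le_pow₀ (one_le_one_add_abs x)
  calc |g x - c| ≤ |g x| + |c| := abs_sub _ _
    _ ≤ C * (1 + |x|) ^ k + |c| * (1 + |x|) ^ k :=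
        add_le_add (hg x) (le_mul_of_one_le_right (abs_nonneg _) h1)
    _ = _ := by ring

lemma PolyBounded.comp_affine {g : ℝ → ℝ} (hg : PolyBounded g) (a b : ℝ) :
    PolyBounded (fun x => g (a * x + b)) := by
  obtain ⟨C, k, hC, hg⟩ := hg
  refine ⟨C * (1 + |a| + |b|) ^ k, k, by positivity, fun x => (hg _).trans ?_⟩
  rw [mul_assoc, ← mul_pow]
  gcongr
  have := abs_add_le (a * x) b
  rw [abs_mul] at this
  nlinarith [abs_nonneg a, abs_nonneg b, abs_nonneg x, mul_nonneg (abs_nonneg b) (abs_nonneg x)]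

lemma PolyBounded.integrable {g : ℝ → ℝ} (hg : PolyBounded g) {ν : Measure ℝ}
    (hν : HasMoments ν) (hm : AEStronglyMeasurable g ν) : Integrable g ν := by
  obtain ⟨C, k, hC, hg⟩ := hg
  exact ((hν k).const_mul C).mono' hm (ae_of_all _ hg)

lemma HasMoments.of_pow {ν : Measure ℝ} [IsFiniteMeasure ν]
    (h : ∀ k : ℕ, Integrable (fun x => |x| ^ k) ν) : HasMoments ν := by
  intro k
  simp only [add_comm (1 : ℝ), add_pow, one_pow, mul_one]
  exact integrable_finsetSum _ fun i _ => (h i).mul_const _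

/-- The differentiable functions on `ℝ` with a derivative of at most polynomial growth. -/
structure PolySmooth (g : ℝ → ℝ) : Prop where
  differentiable : Differentiable ℝ g
  polyBounded_deriv : PolyBounded (deriv g)

/-- Mean value inequality on `[-|x|, |x|]`, where the weight is largest at the endpoints. The offset
`A` is free because the iteration in the Poincaré inequality needs a large one. -/
lemma PolySmooth.abs_sub_le {g : ℝ → ℝ} (hg : Differentiable ℝ g) {C A : ℝ} {k : ℕ}
    (hC : 0 ≤ C) (hA : 0 ≤ A) (hb : ∀ x, |deriv g x| ≤ C * (A + |x|) ^ k) (x : ℝ) :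
    |g x - g 0| ≤ C * (A + |x|) ^ k * |x| := by
  have := Convex.norm_image_sub_le_of_norm_deriv_le (f := g) (s := Icc (-|x|) |x|)
    (C := C * (A + |x|) ^ k) (x := 0) (y := x) (fun y _ => hg y)
    (fun y hy => (hb y).trans (by have := abs_le.2 hy; gcongr)) (convex_Icc _ _)
    ⟨by linarith [abs_nonneg x], abs_nonneg x⟩ ⟨neg_abs_le x, le_abs_self x⟩
  simpa using this

lemma PolySmooth.polyBounded {g : ℝ → ℝ} (hg : PolySmooth g) : PolyBounded g := by
  obtain ⟨hd, C, k, hC, hb⟩ := hg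
  refine ⟨C + |g 0|, k + 1, by positivity, fun x => ?_⟩
  have h1 := PolySmooth.abs_sub_le hd hC zero_le_one hb x
  have h2 : |g x| ≤ |g x - g 0| + |g 0| := by simpa using abs_add_le (g x - g 0) (g 0)
  have h3 : 1 ≤ (1 + |x|) ^ (k + 1) := one_le_pow₀ (one_le_one_add_abs x)
  have h4 : C * (1 + |x|) ^ k * |x| ≤ C * (1 + |x|) ^ (k + 1) := by
    rw [pow_succ, ← mul_assoc]; gcongr; linarith
  nlinarith [abs_nonneg (g 0)]

lemma PolySmooth.comp_add_const {g : ℝ → ℝ} (hg : PolySmooth g) (y : ℝ) :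
    PolySmooth (fun x => g (x + y)) := by
  refine ⟨fun x => (hg.differentiable (x + y)).comp x (by fun_prop), ?_⟩
  have : deriv (fun x => g (x + y)) = fun x => deriv g (1 * x + y) := by
    ext x; rw [deriv_comp_add_const, one_mul]
  rw [this]
  exact hg.polyBounded_deriv.comp_affine 1 y

/-! ### The exponential law and its Hardy inequality. -/

section Exponential

variable {lam : ℝ}

lemma expMeasure_eq (lam : ℝ) : expMeasure lam = (volume.restrict (Ici 0)).withDensity
    (fun x => ENNReal.ofReal (lam * Real.exp (-(lam * x)))) := by
  rw [← withDensity_indicator measurableSet_Ici]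
  change volume.withDensity (exponentialPDF lam) = _
  congr 1
  ext x
  rw [exponentialPDF_eq]
  by_cases hx : 0 ≤ x <;> simp [hx, indicator]

lemma ae_nonneg_expMeasure (lam : ℝ) : ∀ᵐ x ∂expMeasure lam, 0 ≤ x := by
  rw [expMeasure_eq]
  exact (withDensity_absolutelyContinuous _ _).ae_le (ae_restrict_mem measurableSet_Ici)

lemma integral_expMeasure {E : Type*} [NormedAddCommGroup E] [NormedSpace ℝ E]
    (hlam : 0 < lam) (g : ℝ → E) :
    ∫ x, g x ∂expMeasure lam = ∫ x in Ioi 0, (lam * Real.exp (-(lam * x))) • g x := by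
  rw [expMeasure_eq, integral_withDensity_eq_integral_toReal_smul (by fun_prop) (by simp),
    integral_Ici_eq_integral_Ioi]
  congr with x
  rw [ENNReal.toReal_ofReal (by positivity)]

lemma integrable_expMeasure_iff {E : Type*} [NormedAddCommGroup E] [NormedSpace ℝ E]
    (hlam : 0 < lam) (g : ℝ → E) :
    Integrable g (expMeasure lam) ↔
      IntegrableOn (fun x => (lam * Real.exp (-(lam * x))) • g x) (Ioi 0) := by
  rw [expMeasure_eq, integrable_withDensity_iff_integrable_smul' (by fun_prop) (by simp),
    ← integrableOn_Ici_iff_integrableOn_Ioi]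
  unfold IntegrableOn
  congr! with x
  rw [ENNReal.toReal_ofReal (by positivity)]

lemma hasMoments_expMeasure (hlam : 0 < lam) : HasMoments (expMeasure lam) := by
  have := isProbabilityMeasure_expMeasure hlam
  refine HasMoments.of_pow fun k => ?_
  rw [integrable_expMeasure_iff hlam]
  have hi := integrableOn_rpow_mul_exp_neg_mul_rpow (s := k) (p := 1) (b := lam)
    (by have : (0:ℝ) ≤ k := k.cast_nonneg
        linarith) one_pos hlam
  refine IntegrableOn.congr_fun (hi.const_mul lam) ?_ measurableSet_Ioi
  intro x hx
  simp only [mem_Ioi] at hx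
  simp [abs_of_pos hx]
  ring

lemma expMeasure_Iic (hlam : 0 < lam) {t : ℝ} (ht : 0 ≤ t) :
    (expMeasure lam).real (Iic t) = 1 - Real.exp (-(lam * t)) := by
  have := isProbabilityMeasure_expMeasure hlam
  rw [← cdf_eq_real, cdf_expMeasure_eq hlam, if_pos ht]

/-- The product form, free of division, is the one that meets `charFun_mul_eq`. -/
lemma charFun_expMeasure (hlam : 0 < lam) (θ : ℝ) :
    charFun (expMeasure lam) θ * (lam - θ * Complex.I) = lam := by
  have hre : 0 < ((lam : ℂ) - θ * Complex.I).re := by simpa using hlam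
  have hne : (lam : ℂ) - θ * Complex.I ≠ 0 := by
    intro h; rw [h] at hre; simp at hre
  rw [charFun_apply_real, integral_expMeasure hlam]
  have : ∀ x : ℝ, (lam * Real.exp (-(lam * x))) • Complex.exp (θ * x * Complex.I)
      = lam * Complex.exp ((-(lam - θ * Complex.I)) * x) := by
    intro x
    rw [Complex.real_smul]
    push_cast
    rw [mul_assoc, ← Complex.exp_add]
    congr 2; ring
  simp_rw [this]
  rw [integral_const_mul, integral_exp_mul_complex_Ioi (by simpa using hlam), neg_div_neg_eq]
  simp only [Complex.ofReal_zero, mul_zero, Complex.exp_zero]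
  field_simp

/-- A weighted Hardy inequality for the exponential law. -/
lemma hardy_expMeasure (hlam : 0 < lam) {g : ℝ → ℝ} (hg : PolySmooth g) :
    ∫ x, (g x - g 0) ^ 2 ∂expMeasure lam
      ≤ 4 / lam ^ 2 * ∫ x, deriv g x ^ 2 ∂expMeasure lam := by
  have hmom := hasMoments_expMeasure hlam
  have hgm : Measurable g := hg.differentiable.continuous.measurable
  have hg'm : Measurable (deriv g) := measurable_deriv g
  have hP := hg.polyBounded.sub_const (g 0)
  have i1 : Integrable (fun x => (g x - g 0) ^ 2) (expMeasure lam) :=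
    hP.sq.integrable hmom (by fun_prop)
  have i2 : Integrable (fun x => (g x - g 0) * deriv g x) (expMeasure lam) :=
    (hP.mul hg.polyBounded_deriv).integrable hmom (by fun_prop)
  have i3 : Integrable (fun x => deriv g x ^ 2) (expMeasure lam) :=
    hg.polyBounded_deriv.sq.integrable hmom (by fun_prop)
  -- Integration by parts: the integrand times the density has primitive `-exp (-lam x) (g x - g 0)
  -- ^ 2`, which vanishes at `0`, and at infinity because it is integrable together with its
  -- derivative.
  have key : ∫ x, ((g x - g 0) ^ 2 - 2 / lam * ((g x - g 0) * deriv g x)) ∂expMeasure lam = 0 := by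
    have hder : ∀ x ∈ Ici (0 : ℝ), HasDerivAt (fun x => (lam * Real.exp (-(lam * x))) •
        (-(1 / lam) * (g x - g 0) ^ 2)) ((lam * Real.exp (-(lam * x))) •
        ((g x - g 0) ^ 2 - 2 / lam * ((g x - g 0) * deriv g x))) x := by
      intro x _
      have h1 : HasDerivAt (fun x => lam * Real.exp (-(lam * x)))
          (lam * (Real.exp (-(lam * x)) * (-(lam * 1)))) x :=
        (((hasDerivAt_id x).const_mul lam).neg.exp).const_mul lam
      have h2 := ((((hg.differentiable x).hasDerivAt).sub_const (g 0)).pow 2).const_mul (-(1 / lam))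
      convert! h1.mul h2 using 1
      simp
      field_simp
      ring
    have hi := (integrable_expMeasure_iff hlam _).1 (i1.sub (i2.const_mul (2 / lam)))
    have hi' := (integrable_expMeasure_iff hlam _).1 (i1.const_mul (-(1 / lam)))
    rw [integral_expMeasure hlam, integral_Ioi_of_hasDerivAt_of_tendsto' hder hi
      (tendsto_zero_of_hasDerivAt_of_integrableOn_Ioi (fun x hx => hder x (mem_Ici_of_Ioi hx))
        hi hi')]
    simp
  rw [integral_sub i1 (i2.const_mul _), integral_const_mul] at key
  -- Young's inequality, weighted so that multiplication by `2 / lam` leaves half of the left-hand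
  -- side to absorb; this yields the constant `4 / lam ^ 2`.
  have hle : ∫ x, (g x - g 0) * deriv g x ∂expMeasure lam ≤
      ∫ x, (lam / 4 * (g x - g 0) ^ 2 + 1 / lam * deriv g x ^ 2) ∂expMeasure lam := by
    refine integral_mono i2 ((i1.const_mul _).add (i3.const_mul _)) fun x => ?_
    have : lam / 4 * (g x - g 0) ^ 2 + 1 / lam * deriv g x ^ 2 - (g x - g 0) * deriv g x
        = (lam / 2 * (g x - g 0) - deriv g x) ^ 2 / lam := by field_simp; ring
    have h2 : 0 ≤ (lam / 2 * (g x - g 0) - deriv g x) ^ 2 / lam := by positivity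
    simp only
    linarith
  rw [integral_add (i1.const_mul _) (i3.const_mul _), integral_const_mul, integral_const_mul] at hle
  set a := ∫ x, (g x - g 0) ^ 2 ∂expMeasure lam
  set b := ∫ x, (g x - g 0) * deriv g x ∂expMeasure lam
  set c := ∫ x, deriv g x ^ 2 ∂expMeasure lam
  have h1 := mul_le_mul_of_nonneg_left hle (by positivity : 0 ≤ 2 / lam)
  have h2 : 2 / lam * (lam / 4 * a + 1 / lam * c) = a / 2 + 2 / lam ^ 2 * c := by
    field_simp; ring
  have h3 : 4 / lam ^ 2 * c = 2 * (2 / lam ^ 2 * c) := by ring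
  linarith

end Exponential

/-! ### Averages over random affine maps and their stationary laws. -/

section AffineMean

variable {Ω : Type*} [MeasurableSpace Ω]

/-- The averaging operator `g ↦ 𝔼 [g (A x + B)]` of a random affine map. -/
noncomputable def affineMean (P : Measure Ω) (A B : Ω → ℝ) (g : ℝ → ℝ) (x : ℝ) : ℝ :=
  ∫ ω, g (A ω * x + B ω) ∂P

/-- A random affine map with coefficient in `[0, 1]` and translation having all its moments. -/
structure IsAffineContraction (P : Measure Ω) (A B : Ω → ℝ) : Prop where
  measurable_coeff : Measurable A
  measurable_shift : Measurable B
  coeff_nonneg : ∀ ω, 0 ≤ A ω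
  coeff_le_one : ∀ ω, A ω ≤ 1
  integrable_shift : ∀ k : ℕ, Integrable (fun ω => (1 + |B ω|) ^ k) P

/-- The law `μ` is stationary under the random affine map `x ↦ A x + B`. -/
def IsStationary (μ : Measure ℝ) (P : Measure Ω) (A B : Ω → ℝ) : Prop :=
  (μ.prod P).map (fun p => A p.2 * p.1 + B p.2) = μ

variable {P : Measure Ω} {A B : Ω → ℝ}

lemma IsAffineContraction.one_add_abs_le (h : IsAffineContraction P A B) (x : ℝ) (ω : Ω) :
    1 + |A ω * x + B ω| ≤ (1 + |x|) * (1 + |B ω|) := by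
  have h1 := abs_add_le (A ω * x) (B ω)
  rw [abs_mul, abs_of_nonneg (h.coeff_nonneg ω)] at h1
  have h2 : A ω * |x| ≤ |x| := mul_le_of_le_one_left (abs_nonneg _) (h.coeff_le_one ω)
  nlinarith [mul_nonneg (abs_nonneg x) (abs_nonneg (B ω))]

lemma IsAffineContraction.abs_comp_le (h : IsAffineContraction P A B) {g : ℝ → ℝ} {C : ℝ} {k : ℕ}
    (hC : 0 ≤ C) (hg : ∀ x, |g x| ≤ C * (1 + |x|) ^ k) (x : ℝ) (ω : Ω) :
    |g (A ω * x + B ω)| ≤ C * (1 + |x|) ^ k * (1 + |B ω|) ^ k := by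
  refine (hg _).trans ?_
  rw [mul_assoc, ← mul_pow]
  gcongr
  exact h.one_add_abs_le x ω

lemma IsAffineContraction.integrable_comp (h : IsAffineContraction P A B) {g : ℝ → ℝ}
    (hg : PolyBounded g) (hgm : Measurable g) (x : ℝ) :
    Integrable (fun ω => g (A ω * x + B ω)) P := by
  obtain ⟨C, k, hC, hg⟩ := hg
  have := h.measurable_coeff
  have := h.measurable_shift
  exact ((h.integrable_shift k).const_mul (C * (1 + |x|) ^ k)).mono'
    (Measurable.aestronglyMeasurable (by fun_prop)) (ae_of_all _ (h.abs_comp_le hC hg x))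

lemma IsAffineContraction.integrable_coeff_mul (h : IsAffineContraction P A B) {g : Ω → ℝ}
    (hg : Integrable g P) : Integrable (fun ω => A ω * g ω) P :=
  hg.norm.mono' (h.measurable_coeff.aestronglyMeasurable.mul hg.aestronglyMeasurable)
    (ae_of_all _ fun ω => by
      rw [norm_mul, Real.norm_of_nonneg (h.coeff_nonneg ω)]
      exact mul_le_of_le_one_left (norm_nonneg _) (h.coeff_le_one ω))

lemma IsAffineContraction.hasDerivAt (h : IsAffineContraction P A B) {g : ℝ → ℝ}
    (hg : PolySmooth g) (x : ℝ) :
    HasDerivAt (affineMean P A B g) (∫ ω, A ω * deriv g (A ω * x + B ω) ∂P) x := by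
  have hA := h.measurable_coeff
  have hB := h.measurable_shift
  have hgm : Measurable g := hg.differentiable.continuous.measurable
  have hg'm : Measurable (deriv g) := measurable_deriv g
  obtain ⟨C, k, hC, hb⟩ := hg.polyBounded_deriv
  -- The domination is uniform over the unit ball around `x`, where `1 + |y| ≤ 2 + |x|`.
  refine (hasDerivAt_integral_of_dominated_loc_of_deriv_le (Metric.ball_mem_nhds x one_pos)
    (F := fun x ω => g (A ω * x + B ω)) (F' := fun x ω => A ω * deriv g (A ω * x + B ω))
    (bound := fun ω => C * (2 + |x|) ^ k * (1 + |B ω|) ^ k)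
    (Eventually.of_forall fun y => Measurable.aestronglyMeasurable (by fun_prop)) (h.integrable_comp hg.polyBounded hgm x)
    (Measurable.aestronglyMeasurable (by fun_prop)) (ae_of_all _ fun ω y hy => ?_)
    ((h.integrable_shift k).const_mul _) (ae_of_all _ fun ω y _ => ?_)).2
  · rw [norm_mul, Real.norm_of_nonneg (h.coeff_nonneg ω)]
    refine (mul_le_of_le_one_left (norm_nonneg _) (h.coeff_le_one ω)).trans
      ((h.abs_comp_le hC hb y ω).trans ?_)
    have : |y| ≤ |x| + 1 := by
      have h1 : |y - x| < 1 := by simpa [Real.dist_eq] using hy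
      have h2 := abs_sub_abs_le_abs_sub y x
      linarith
    gcongr ?_ * ?_ ^ _ * _
    linarith
  · have h1 : HasDerivAt (fun y => A ω * y + B ω) (A ω * 1) y :=
      ((hasDerivAt_id y).const_mul _).add_const _
    have h2 := (hg.differentiable (A ω * y + B ω)).hasDerivAt.comp y h1
    convert! h2 using 1
    ring

lemma IsAffineContraction.deriv_affineMean (h : IsAffineContraction P A B) {g : ℝ → ℝ}
    (hg : PolySmooth g) :
    deriv (affineMean P A B g) = fun x => ∫ ω, A ω * deriv g (A ω * x + B ω) ∂P :=
  funext fun x => (h.hasDerivAt hg x).deriv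

lemma IsAffineContraction.polySmooth (h : IsAffineContraction P A B) {g : ℝ → ℝ}
    (hg : PolySmooth g) : PolySmooth (affineMean P A B g) := by
  refine ⟨fun x => (h.hasDerivAt hg x).differentiableAt, ?_⟩
  rw [h.deriv_affineMean hg]
  obtain ⟨C, k, hC, hb⟩ := hg.polyBounded_deriv
  refine ⟨C * ∫ ω, (1 + |B ω|) ^ k ∂P, k, mul_nonneg hC (integral_nonneg fun _ => by positivity),
    fun x => ?_⟩
  rw [← Real.norm_eq_abs]
  refine (norm_integral_le_of_norm_le ((h.integrable_shift k).const_mul (C * (1 + |x|) ^ k))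
    (ae_of_all _ fun ω => ?_)).trans_eq ?_
  · rw [norm_mul, Real.norm_of_nonneg (h.coeff_nonneg ω)]
    exact (mul_le_of_le_one_left (norm_nonneg _) (h.coeff_le_one ω)).trans
      (h.abs_comp_le hC hb x ω)
  · rw [integral_const_mul]; ring

variable {μ : Measure ℝ}

lemma IsAffineContraction.integrable_prod [SFinite μ] [SFinite P] (h : IsAffineContraction P A B)
    (hμ : HasMoments μ) {g : ℝ → ℝ} (hg : PolyBounded g) (hgm : Measurable g) :
    Integrable (fun p : ℝ × Ω => g (A p.2 * p.1 + B p.2)) (μ.prod P) := by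
  obtain ⟨C, k, hC, hb⟩ := hg
  have := h.measurable_coeff
  have := h.measurable_shift
  refine (((hμ k).const_mul C).mul_prod (h.integrable_shift k)).mono'
    (Measurable.aestronglyMeasurable (by fun_prop))
    (ae_of_all _ fun p => h.abs_comp_le hC hb p.1 p.2)

lemma IsAffineContraction.integrable_affineMean [SFinite μ] [SFinite P]
    (h : IsAffineContraction P A B) (hμ : HasMoments μ) {g : ℝ → ℝ} (hg : PolyBounded g)
    (hgm : Measurable g) : Integrable (affineMean P A B g) μ :=
  (h.integrable_prod hμ hg hgm).integral_prod_left

lemma IsStationary.integral_affineMean [SFinite μ] [SFinite P] (hst : IsStationary μ P A B)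
    (h : IsAffineContraction P A B) (hμ : HasMoments μ) {g : ℝ → ℝ} (hg : PolyBounded g)
    (hgm : Measurable g) : ∫ x, affineMean P A B g x ∂μ = ∫ x, g x ∂μ := by
  have := h.measurable_coeff
  have := h.measurable_shift
  conv_rhs => rw [← hst]
  rw [integral_map (by fun_prop) (by fun_prop), integral_prod _ (h.integrable_prod hμ hg hgm)]
  rfl

/-- Cauchy-Schwarz, from the discriminant of the nonnegative quadratic `t ↦ ∫ (f t + g) ^ 2`. -/
lemma sq_integral_mul_le {f g : Ω → ℝ} (hf : Integrable (fun ω => f ω ^ 2) P)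
    (hg : Integrable (fun ω => g ω ^ 2) P) (hfg : Integrable (fun ω => f ω * g ω) P) :
    (∫ ω, f ω * g ω ∂P) ^ 2 ≤ (∫ ω, f ω ^ 2 ∂P) * ∫ ω, g ω ^ 2 ∂P := by
  have key : ∀ t : ℝ, 0 ≤ (∫ ω, f ω ^ 2 ∂P) * (t * t) + (2 * ∫ ω, f ω * g ω ∂P) * t
      + ∫ ω, g ω ^ 2 ∂P := by
    intro t
    have : 0 ≤ ∫ ω, (f ω ^ 2 * (t * t) + f ω * g ω * (2 * t) + g ω ^ 2) ∂P :=
      integral_nonneg fun ω => by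
        have : f ω ^ 2 * (t * t) + f ω * g ω * (2 * t) + g ω ^ 2 = (f ω * t + g ω) ^ 2 := by ring
        simp only [this]
        positivity
    rw [integral_add (by exact (hf.mul_const _).add (hfg.mul_const _)) hg,
      integral_add (hf.mul_const _) (hfg.mul_const _), integral_mul_const, integral_mul_const]
      at this
    linarith
  have := discrim_le_zero key
  rw [discrim] at this
  linarith

/-- The derivative of the average is `𝔼 [A g' (A x + B)]`. Cauchy-Schwarz for each `x` separates `A`
from `g'`, and stationarity removes the average of `g' ^ 2`. Used both for one step of the
fixed-point map and for the semigroup. -/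
lemma IsStationary.integral_sq_deriv_affineMean_le [SFinite μ] [IsProbabilityMeasure P]
    (hst : IsStationary μ P A B) (h : IsAffineContraction P A B) (hμ : HasMoments μ) {g : ℝ → ℝ}
    (hg : PolySmooth g) :
    ∫ x, deriv (affineMean P A B g) x ^ 2 ∂μ
      ≤ (∫ ω, A ω ^ 2 ∂P) * ∫ x, deriv g x ^ 2 ∂μ := by
  have hg'm : Measurable (deriv g) := measurable_deriv g
  have hsq : Measurable (fun x => deriv g x ^ 2) := by fun_prop
  rw [← hst.integral_affineMean h hμ hg.polyBounded_deriv.sq hsq, ← integral_const_mul]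
  refine integral_mono ((h.polySmooth hg).polyBounded_deriv.sq.integrable hμ
    (by have := measurable_deriv (affineMean P A B g); fun_prop))
    ((h.integrable_affineMean hμ hg.polyBounded_deriv.sq hsq).const_mul _) fun x => ?_
  have hi := h.integrable_comp hg.polyBounded_deriv hg'm x
  simp only [h.deriv_affineMean hg]
  refine sq_integral_mul_le ?_ (h.integrable_comp hg.polyBounded_deriv.sq hsq x)
    (h.integrable_coeff_mul hi)
  have := h.integrable_coeff_mul (h.integrable_coeff_mul (integrable_const (1 : ℝ)))
  simpa [pow_two] using this

end AffineMean

/-- Bias-variance decomposition around `m`; the mean minimises the quadratic deviation, so the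
variance is at most the deviation from any `c`. -/
lemma integral_sq_sub_le {Ω : Type*} [MeasurableSpace Ω] {P : Measure Ω} [IsProbabilityMeasure P]
    {h : Ω → ℝ} (h1 : Integrable h P) (h2 : Integrable (fun ω => h ω ^ 2) P) (c m : ℝ) :
    ∫ ω, (h ω - m) ^ 2 ∂P ≤ ∫ ω, (h ω - c) ^ 2 ∂P + (∫ ω, h ω ∂P - m) ^ 2 := by
  have key : ∀ c : ℝ, ∫ ω, (h ω - c) ^ 2 ∂P = ∫ ω, h ω ^ 2 ∂P - 2 * c * ∫ ω, h ω ∂P + c ^ 2 := by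
    intro c
    have : ∀ ω, (h ω - c) ^ 2 = h ω ^ 2 - 2 * c * h ω + c ^ 2 := fun ω => by ring
    simp_rw [this]
    rw [integral_add (by exact h2.sub (h1.const_mul _)) (integrable_const _),
      integral_sub h2 (h1.const_mul _), integral_const_mul]
    simp
  rw [key, key]
  nlinarith [sq_nonneg (∫ ω, h ω ∂P - c)]

/-! ### The Poincaré inequality from the fixed-point equation. -/

section Poincare

variable {lam δ : ℝ} {μ : Measure ℝ}

lemma isAffineContraction_exp (hlam : 0 < lam) (hδ0 : 0 ≤ δ) (hδ1 : δ < 1) :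
    IsAffineContraction (expMeasure lam) (fun _ => δ) id where
  measurable_coeff := measurable_const
  measurable_shift := measurable_id
  coeff_nonneg _ := hδ0
  coeff_le_one _ := hδ1.le
  integrable_shift := hasMoments_expMeasure hlam

/-- Bias-variance decomposition conditionally on `x`, with the conditional variance replaced by the
deviation from `g (δ x)`, which Hardy's inequality controls. -/
lemma variance_le_add_variance_affineMean [IsProbabilityMeasure μ] (hlam : 0 < lam) (hδ0 : 0 ≤ δ)
    (hδ1 : δ < 1) (hst : IsStationary μ (expMeasure lam) (fun _ => δ) id) (hμ : HasMoments μ)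
    {g : ℝ → ℝ} (hg : PolySmooth g) (m : ℝ) :
    ∫ x, (g x - m) ^ 2 ∂μ ≤ 4 / lam ^ 2 * ∫ x, deriv g x ^ 2 ∂μ
      + ∫ x, (affineMean (expMeasure lam) (fun _ => δ) id g x - m) ^ 2 ∂μ := by
  have := isProbabilityMeasure_expMeasure hlam
  have h := isAffineContraction_exp hlam hδ0 hδ1
  have hgm : Measurable g := hg.differentiable.continuous.measurable
  have hg'm : Measurable (deriv g) := measurable_deriv g
  have p1 := (hg.polyBounded.sub_const m).sq
  have p2 := hg.polyBounded_deriv.sq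
  have m1 : Measurable (fun x => (g x - m) ^ 2) := by fun_prop
  have m2 : Measurable (fun x => deriv g x ^ 2) := by fun_prop
  have hT := h.polySmooth hg
  have i3 : Integrable (fun x => (affineMean (expMeasure lam) (fun _ => δ) id g x - m) ^ 2) μ :=
    (hT.polyBounded.sub_const m).sq.integrable hμ
      (by have := hT.differentiable.continuous.measurable; fun_prop)
  rw [← hst.integral_affineMean h hμ p1 m1, ← hst.integral_affineMean h hμ p2 m2,
    ← integral_const_mul, ← integral_add ((h.integrable_affineMean hμ p2 m2).const_mul _) i3]
  refine integral_mono (h.integrable_affineMean hμ p1 m1)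
    (((h.integrable_affineMean hμ p2 m2).const_mul _).add i3) fun x => ?_
  refine (integral_sq_sub_le (h.integrable_comp hg.polyBounded hgm x)
    (h.integrable_comp hg.polyBounded.sq (by fun_prop) x) (g (δ * x)) m).trans ?_
  refine add_le_add_left ?_ _
  -- The translate `e ↦ g (e + δ x)` takes the value `g (δ x)` at `0`.
  have := hardy_expMeasure hlam (hg.comp_add_const (δ * x))
  simp only [zero_add, deriv_comp_add_const] at this
  simpa only [affineMean, id, add_comm] using this

/-- Makes the remainder of the iteration vanish: with the weight `(a + |x|) ^ k` and `a` large,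
averaging contracts derivatives in weighted sup norm. By dominated convergence the integral tends to
`1` as `a → ∞`, and `δ < 1` leaves room. -/
lemma exists_growth_contraction (hlam : 0 < lam) (hδ1 : δ < 1) (k : ℕ) :
    ∃ a q : ℝ, 1 ≤ a ∧ 0 ≤ q ∧ q < 1 ∧ δ * ∫ e, (1 + |e| / a) ^ k ∂expMeasure lam ≤ q := by
  have := isProbabilityMeasure_expMeasure hlam
  have hlim : Tendsto (fun n : ℕ => ∫ e, (1 + |e| / ((n : ℝ) + 1)) ^ k ∂expMeasure lam) atTop
      (𝓝 (∫ _, 1 ∂expMeasure lam)) := by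
    refine tendsto_integral_of_dominated_convergence (fun e => (1 + |e|) ^ k)
      (fun n => by fun_prop) (hasMoments_expMeasure hlam k) (fun n => ae_of_all _ fun e => ?_)
      (ae_of_all _ fun e => ?_)
    · rw [Real.norm_of_nonneg (by positivity)]
      gcongr
      exact div_le_self (abs_nonneg _) (by linarith [n.cast_nonneg (α := ℝ)])
    · have h1 : Tendsto (fun n : ℕ => |e| / ((n : ℝ) + 1)) atTop (𝓝 0) :=
        tendsto_const_nhds.div_atTop
          (tendsto_atTop_add_const_right _ _ tendsto_natCast_atTop_atTop)
      simpa using (h1.const_add 1).pow k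
  simp only [integral_const, probReal_univ, smul_eq_mul, mul_one] at hlim
  have h2 := hlim.const_mul δ
  rw [mul_one] at h2
  obtain ⟨n, hn⟩ := (h2.eventually (gt_mem_nhds (lt_max_of_lt_left
    (by linarith : δ < (1 + δ) / 2) : δ < max ((1 + δ) / 2) 0))).exists
  exact ⟨n + 1, max ((1 + δ) / 2) 0, by linarith [n.cast_nonneg (α := ℝ)], le_max_right _ _,
    max_lt (by linarith) one_pos, hn.le⟩

/-- The chain rule gives the factor `δ`, and `a + |δ x + e| ≤ (a + |x|) (1 + |e| / a)` splits the
weight. -/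
lemma abs_deriv_affineMean_le (hlam : 0 < lam) (hδ0 : 0 ≤ δ) (hδ1 : δ < 1) {g : ℝ → ℝ}
    (hg : PolySmooth g) {C a q : ℝ} {k : ℕ} (hC : 0 ≤ C) (ha : 1 ≤ a)
    (hq : δ * ∫ e, (1 + |e| / a) ^ k ∂expMeasure lam ≤ q)
    (hb : ∀ x, |deriv g x| ≤ C * (a + |x|) ^ k) (x : ℝ) :
    |deriv (affineMean (expMeasure lam) (fun _ => δ) id g) x| ≤ C * q * (a + |x|) ^ k := by
  have h := isAffineContraction_exp hlam hδ0 hδ1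
  rw [h.deriv_affineMean hg]
  have hi : Integrable (fun e => (1 + |e| / a) ^ k) (expMeasure lam) := by
    refine (hasMoments_expMeasure hlam k).mono' (by fun_prop) (ae_of_all _ fun e => ?_)
    rw [Real.norm_of_nonneg (by positivity)]
    gcongr
    exact div_le_self (abs_nonneg _) ha
  rw [← Real.norm_eq_abs]
  refine (norm_integral_le_of_norm_le (hi.const_mul (δ * (C * (a + |x|) ^ k)))
    (ae_of_all _ fun e => ?_)).trans ?_
  · rw [norm_mul, Real.norm_of_nonneg hδ0, mul_assoc, mul_assoc C, ← mul_pow]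
    refine mul_le_mul_of_nonneg_left ((hb _).trans ?_) hδ0
    gcongr
    have h1 := abs_add_le (δ * x) (id e)
    rw [abs_mul, abs_of_nonneg hδ0] at h1
    have h2 : δ * |x| ≤ |x| := mul_le_of_le_one_left (abs_nonneg _) hδ1.le
    have h3 : (a + |x|) * (1 + |e| / a) = a + |x| + |e| + |x| * (|e| / a) := by
      field_simp; ring
    have h4 : 0 ≤ |x| * (|e| / a) := by positivity
    rw [h3]
    simp only [id] at h1 ⊢
    linarith
  · rw [integral_const_mul]
    calc _ = C * (a + |x|) ^ k * (δ * ∫ e, (1 + |e| / a) ^ k ∂expMeasure lam) := by ring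
      _ ≤ C * (a + |x|) ^ k * q := by gcongr
      _ = _ := by ring

/-- The Poincaré inequality for the stationary law of `x ↦ δ x + E`, with `E` exponential. -/
lemma poincare_of_isStationary [IsProbabilityMeasure μ] (hlam : 0 < lam) (hδ0 : 0 ≤ δ)
    (hδ1 : δ < 1) (hst : IsStationary μ (expMeasure lam) (fun _ => δ) id) (hμ : HasMoments μ)
    {g : ℝ → ℝ} (hg : PolySmooth g) :
    ∫ x, (g x - ∫ y, g y ∂μ) ^ 2 ∂μ
      ≤ 4 / (lam ^ 2 * (1 - δ ^ 2)) * ∫ x, deriv g x ^ 2 ∂μ := by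
  have := isProbabilityMeasure_expMeasure hlam
  have h := isAffineContraction_exp hlam hδ0 hδ1
  have hδ2 : 0 < 1 - δ ^ 2 := by nlinarith
  obtain ⟨C, k, hC, hb⟩ := hg.polyBounded_deriv
  obtain ⟨a, q, ha, hq0, hq1, hq⟩ := exists_growth_contraction hlam hδ1 k
  set M := ∫ x, ((a + |x|) ^ k * |x|) ^ 2 ∂μ
  have hMi : Integrable (fun x => ((a + |x|) ^ k * |x|) ^ 2) μ := by
    refine PolyBounded.integrable (.sq ⟨a ^ k, k + 1, by positivity, fun x => ?_⟩) hμ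
      (by fun_prop)
    rw [abs_of_nonneg (by positivity), pow_succ, ← mul_assoc, ← mul_pow]
    gcongr
    · nlinarith [abs_nonneg x]
    · linarith
  -- Stated for all `g` and `C`, since the induction passes to `T g` with constant `C q`. The final
  -- constant stands at every stage; only the remainder shrinks.
  have key : ∀ (n : ℕ) (g : ℝ → ℝ) (C : ℝ), PolySmooth g → 0 ≤ C →
      (∀ x, |deriv g x| ≤ C * (a + |x|) ^ k) → ∫ x, (g x - ∫ y, g y ∂μ) ^ 2 ∂μ
      ≤ 4 / (lam ^ 2 * (1 - δ ^ 2)) * ∫ x, deriv g x ^ 2 ∂μ + (C * q ^ n) ^ 2 * M := by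
    intro n
    induction n with
    | zero =>
      intro g C hg hC hb
      have hgm : Measurable g := hg.differentiable.continuous.measurable
      have h0 := integral_sq_sub_le (hg.polyBounded.integrable hμ (by fun_prop))
        (hg.polyBounded.sq.integrable hμ (by fun_prop)) (g 0) (∫ y, g y ∂μ)
      have h1 : ∫ x, (g x - g 0) ^ 2 ∂μ ≤ ∫ x, C ^ 2 * ((a + |x|) ^ k * |x|) ^ 2 ∂μ := by
        refine integral_mono ((hg.polyBounded.sub_const _).sq.integrable hμ (by fun_prop))
          (hMi.const_mul _) fun x => ?_
        have := PolySmooth.abs_sub_le hg.differentiable hC (by linarith) hb x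
        have h2 := pow_le_pow_left₀ (abs_nonneg _) this 2
        rw [sq_abs] at h2
        refine h2.trans_eq (by ring)
      rw [integral_const_mul] at h1
      have h3 : 0 ≤ 4 / (lam ^ 2 * (1 - δ ^ 2)) * ∫ x, deriv g x ^ 2 ∂μ :=
        mul_nonneg (by positivity) (integral_nonneg fun x => sq_nonneg _)
      simp only [sub_self, pow_zero, mul_one] at h0 ⊢
      linarith
    | succ n ih =>
      intro g C hg hC hb
      have h1 := variance_le_add_variance_affineMean hlam hδ0 hδ1 hst hμ hg (∫ y, g y ∂μ)
      have h2 := ih _ (C * q) (h.polySmooth hg) (by positivity)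
        (abs_deriv_affineMean_le hlam hδ0 hδ1 hg hC ha hq hb)
      rw [hst.integral_affineMean h hμ hg.polyBounded
        hg.differentiable.continuous.measurable] at h2
      have h3 := hst.integral_sq_deriv_affineMean_le h hμ hg
      simp only [integral_const, probReal_univ, smul_eq_mul, one_mul] at h3
      have h4 := mul_le_mul_of_nonneg_left h3 (by positivity : 0 ≤ 4 / (lam ^ 2 * (1 - δ ^ 2)))
      -- The constant `K = 4 / (lam ^ 2 (1 - δ ^ 2))` solves `K = 4 / lam ^ 2 + δ ^ 2 K`.
      have h5 : ∀ D : ℝ, 4 / lam ^ 2 * D + 4 / (lam ^ 2 * (1 - δ ^ 2)) * (δ ^ 2 * D)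
          = 4 / (lam ^ 2 * (1 - δ ^ 2)) * D := fun D => by field_simp; ring
      have h6 := h5 (∫ x, deriv g x ^ 2 ∂μ)
      rw [pow_succ' q, ← mul_assoc]
      linarith
  have hb' : ∀ x, |deriv g x| ≤ C * (a + |x|) ^ k := fun x => (hb x).trans (by gcongr)
  have hlim : Tendsto (fun n : ℕ => 4 / (lam ^ 2 * (1 - δ ^ 2)) * ∫ x, deriv g x ^ 2 ∂μ
      + (C * q ^ n) ^ 2 * M) atTop
      (𝓝 (4 / (lam ^ 2 * (1 - δ ^ 2)) * ∫ x, deriv g x ^ 2 ∂μ + (C * 0) ^ 2 * M)) :=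
    ((((tendsto_pow_atTop_nhds_zero_of_lt_one hq0 hq1).const_mul C).pow 2).mul_const M).const_add _
  simp only [mul_zero, ne_eq, OfNat.ofNat_ne_zero, not_false_eq_true, zero_pow, zero_mul,
    add_zero] at hlim
  exact ge_of_tendsto' hlim fun n => key n g C hg hC hb'

end Poincare

/-! ### Moments of the stationary law. -/

section Moments

variable {lam δ : ℝ} {μ : Measure ℝ}

/-- Convexity of the power at `δ x + (1 - δ) (e / (1 - δ))`. -/
lemma affine_pow_le {x e : ℝ} (hδ0 : 0 ≤ δ) (hδ1 : δ < 1) (hx : 0 ≤ x) (he : 0 ≤ e) (k : ℕ) :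
    (δ * x + e) ^ k ≤ δ * x ^ k + (1 - δ) * (1 / (1 - δ)) ^ k * e ^ k := by
  have h1 : 0 < 1 - δ := by linarith
  have := (convexOn_pow (𝕜 := ℝ) k).2 (mem_Ici.2 hx)
    (mem_Ici.2 (div_nonneg he h1.le)) hδ0 h1.le (by ring)
  simp only [smul_eq_mul] at this
  rw [mul_div_cancel₀ _ h1.ne'] at this
  refine this.trans_eq ?_
  rw [div_pow, div_pow]; ring

/-- Comparing `k`-th moments in `X ↦ δ X + E` would subtract possibly infinite quantities;
truncation at `M` makes them finite, with a bound independent of `M`. -/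
lemma integral_min_sub_min_le [IsProbabilityMeasure μ] (hlam : 0 < lam) (hδ0 : 0 ≤ δ)
    (hδ1 : δ < 1) (hst : IsStationary μ (expMeasure lam) (fun _ => δ) id)
    (hpos : ∀ᵐ x ∂μ, 0 ≤ x) (k : ℕ) {M : ℝ} (hM : 0 ≤ M) :
    ∫ x, (min (|x| ^ k) M - min (δ * |x| ^ k) M) ∂μ
      ≤ (1 - δ) * (1 / (1 - δ)) ^ k * ∫ e, |e| ^ k ∂expMeasure lam := by
  have := isProbabilityMeasure_expMeasure hlam
  set c := (1 - δ) * (1 / (1 - δ)) ^ k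
  have hc : 0 ≤ c := by
    have : 0 ≤ 1 - δ := by linarith
    positivity
  have hb : ∀ {Ω : Type} [MeasurableSpace Ω] (P : Measure Ω) [IsFiniteMeasure P] (f : Ω → ℝ),
      Measurable f → (∀ ω, 0 ≤ f ω) → Integrable (fun ω => min (f ω) M) P := by
    intro Ω _ P _ f hf h0
    refine Integrable.of_bound (C := M) (Measurable.aestronglyMeasurable (by fun_prop))
      (ae_of_all _ fun ω => ?_)
    rw [Real.norm_of_nonneg (le_min (h0 ω) hM)]
    exact min_le_right _ _
  have i1 := hb μ (fun x => |x| ^ k) (by fun_prop) (fun x => by positivity)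
  have i2 := hb μ (fun x => δ * |x| ^ k) (by fun_prop) (fun x => by positivity)
  have i3 := hb (μ.prod (expMeasure lam)) (fun p => |δ * p.1 + id p.2| ^ k) (by fun_prop)
    (fun x => by positivity)
  have i4 : Integrable (fun e : ℝ => |e| ^ k) (expMeasure lam) :=
    PolyBounded.integrable ⟨1, k, zero_le_one, fun x => by
      rw [abs_of_nonneg (by positivity), one_mul]; gcongr; linarith⟩
      (hasMoments_expMeasure hlam) (by fun_prop)
  have h1 : ∫ x, min (|x| ^ k) M ∂μ
      = ∫ p : ℝ × ℝ, min (|δ * p.1 + id p.2| ^ k) M ∂(μ.prod (expMeasure lam)) := by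
    conv_lhs => rw [← hst]
    rw [integral_map (Measurable.aemeasurable (by fun_prop))
      (Measurable.aestronglyMeasurable (by fun_prop))]
  have i5 : Integrable (fun p : ℝ × ℝ => min (δ * |p.1| ^ k) M) (μ.prod (expMeasure lam)) :=
    i2.comp_fst _
  have i6 : Integrable (fun p : ℝ × ℝ => c * |p.2| ^ k) (μ.prod (expMeasure lam)) :=
    (i4.const_mul c).comp_snd _
  have h2 : ∫ p : ℝ × ℝ, min (|δ * p.1 + id p.2| ^ k) M ∂(μ.prod (expMeasure lam))
      ≤ ∫ p : ℝ × ℝ, (min (δ * |p.1| ^ k) M + c * |p.2| ^ k) ∂(μ.prod (expMeasure lam)) := by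
    refine integral_mono_ae i3 (i5.add i6) ?_
    have hx : ∀ᵐ p ∂(μ.prod (expMeasure lam)), 0 ≤ p.1 :=
      Measure.quasiMeasurePreserving_fst.ae hpos
    have he : ∀ᵐ p ∂(μ.prod (expMeasure lam)), 0 ≤ p.2 :=
      Measure.quasiMeasurePreserving_snd.ae (ae_nonneg_expMeasure lam)
    filter_upwards [hx, he] with p hx he
    have h := affine_pow_le hδ0 hδ1 hx he k
    rw [abs_of_nonneg hx, abs_of_nonneg he, id, abs_of_nonneg (by positivity)]
    have h0 : 0 ≤ c * p.2 ^ k := by positivity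
    rw [← min_add_add_right]
    exact min_le_min h (by linarith)
  rw [integral_add i5 i6, integral_fun_fst (fun x => min (δ * |x| ^ k) M),
    integral_fun_snd (fun e => c * |e| ^ k), integral_const_mul] at h2
  simp only [probReal_univ, one_smul] at h2
  rw [integral_sub i1 i2]
  linarith

lemma IsStationary.hasMoments [IsProbabilityMeasure μ] (hlam : 0 < lam) (hδ0 : 0 ≤ δ)
    (hδ1 : δ < 1) (hst : IsStationary μ (expMeasure lam) (fun _ => δ) id)
    (hpos : ∀ᵐ x ∂μ, 0 ≤ x) : HasMoments μ := by
  refine HasMoments.of_pow fun k => ?_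
  have hcov : AECover μ atTop (fun n : ℕ => {x : ℝ | |x| ^ k ≤ n}) := by
    refine ⟨ae_of_all _ fun x => ?_, fun n => measurableSet_le (by fun_prop) (by fun_prop)⟩
    filter_upwards [eventually_ge_atTop ⌈|x| ^ k⌉₊] with n hn
    exact Nat.ceil_le.1 hn
  have hint : ∀ n : ℕ, IntegrableOn (fun x : ℝ => |x| ^ k) {x : ℝ | |x| ^ k ≤ n} μ := by
    intro n
    refine Measure.integrableOn_of_bounded (M := n) (measure_ne_top _ _) (by fun_prop) ?_
    filter_upwards [ae_restrict_mem (hcov.measurableSet n)] with x hx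
    rw [Real.norm_of_nonneg (by positivity)]
    exact hx
  refine hcov.integrable_of_integral_bounded_of_nonneg_ae
    (1 / (1 - δ) * ((1 - δ) * (1 / (1 - δ)) ^ k * ∫ e, |e| ^ k ∂expMeasure lam)) hint
    (ae_of_all _ fun x => by positivity) (Eventually.of_forall fun n => ?_)
  have h1 : 0 < 1 - δ := by linarith
  have h := integral_min_sub_min_le hlam hδ0 hδ1 hst hpos k (Nat.cast_nonneg (α := ℝ) n)
  have hM : (0 : ℝ) ≤ n := n.cast_nonneg
  rw [one_div (1 - δ), le_inv_mul_iff₀ h1, ← one_div (1 - δ)]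
  refine le_trans ?_ h
  -- With `w = |x| ^ k`, the difference of minima equals `(1 - δ) w` where `w ≤ n` and is
  -- nonnegative elsewhere.
  rw [← integral_indicator (hcov.measurableSet n), ← integral_const_mul]
  refine integral_mono (((integrable_indicator_iff (hcov.measurableSet n)).2 (hint n)).const_mul _)
    ?_ fun x => ?_
  · refine Integrable.of_bound (C := 2 * n) (Measurable.aestronglyMeasurable (by fun_prop))
      (ae_of_all _ fun x => ?_)
    have h2 : 0 ≤ min (|x| ^ k) (n : ℝ) := by positivity
    have h3 : 0 ≤ min (δ * |x| ^ k) (n : ℝ) := by positivity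
    have h4 := min_le_right (|x| ^ k) (n : ℝ)
    have h5 := min_le_right (δ * |x| ^ k) (n : ℝ)
    rw [Real.norm_eq_abs, abs_le]
    constructor <;> linarith
  · have hw : 0 ≤ |x| ^ k := by positivity
    have hδw : δ * |x| ^ k ≤ |x| ^ k := mul_le_of_le_one_left hw hδ1.le
    by_cases hx : |x| ^ k ≤ n
    · simp only [indicator, mem_ofPred_eq, hx, if_true, min_eq_left, min_eq_left (hδw.trans hx)]
      linarith
    · simp only [indicator, mem_ofPred_eq, hx, if_false, mul_zero, sub_nonneg]
      exact min_le_min_right _ hδw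

end Moments

/-! ### The clock sequence, jump times and jump count. -/

section Clock

variable {lam δ : ℝ}

/-- The sequence obtained by putting `a` in front of `ω`. -/
def consSeq (a : ℝ) (ω : ℕ → ℝ) : ℕ → ℝ
  | 0 => a
  | n + 1 => ω n

lemma measurable_consSeq : Measurable (fun p : ℝ × (ℕ → ℝ) => consSeq p.1 p.2) := by
  refine measurable_pi_iff.2 fun n => ?_
  cases n with
  | zero => exact measurable_fst
  | succ n => exact (measurable_pi_apply n).comp measurable_snd

lemma isProbabilityMeasure_clockLaw (hlam : 0 < lam) : IsProbabilityMeasure (clockLaw lam) := by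
  have := isProbabilityMeasure_expMeasure hlam
  unfold clockLaw
  infer_instance

lemma clockLaw_pi (hlam : 0 < lam) (s : Finset ℕ) {t : ℕ → Set ℝ}
    (ht : ∀ i, MeasurableSet (t i)) :
    clockLaw lam (Set.pi s t) = ∏ i ∈ s, expMeasure lam (t i) := by
  have := isProbabilityMeasure_expMeasure hlam
  exact Measure.infinitePi_pi _ fun i _ => ht i

/-- The renewal structure: the first clock is independent of the rest, which has the same law.
Checked on cylinders, padded with `univ` to an initial segment so that the preimage is a rectangle.
-/
lemma map_consSeq_clockLaw (hlam : 0 < lam) :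
    ((expMeasure lam).prod (clockLaw lam)).map (fun p => consSeq p.1 p.2) = clockLaw lam := by
  classical
  have := isProbabilityMeasure_expMeasure hlam
  have := isProbabilityMeasure_clockLaw hlam
  refine Measure.eq_infinitePi _ fun s t ht => ?_
  obtain ⟨N, hN⟩ : ∃ N, s ⊆ Finset.range (N + 1) :=
    ⟨s.sup id, fun i hi => Finset.mem_range.2 (Nat.lt_succ_of_le (Finset.le_sup (f := id) hi))⟩
  set t' : ℕ → Set ℝ := fun i => if i ∈ s then t i else univ with ht'
  have hm : ∀ i, MeasurableSet (t' i) := fun i => by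
    by_cases hi : i ∈ s <;> simp [ht', hi, ht i]
  have hpi : Set.pi (s : Set ℕ) t = Set.pi (Finset.range (N + 1) : Set ℕ) t' := by
    ext ω
    simp only [Set.mem_pi, ht', Finset.mem_coe]
    refine ⟨fun h i _ => ?_, fun h i hi => by simpa [hi] using h i (hN hi)⟩
    by_cases hi : i ∈ s <;> simp [hi, h i]
  have hprod : ∏ i ∈ s, expMeasure lam (t i)
      = ∏ i ∈ Finset.range (N + 1), expMeasure lam (t' i) := by
    rw [← Finset.prod_subset hN (fun i _ hi => by simp [ht', hi])]
    exact Finset.prod_congr rfl fun i hi => by simp [ht', hi]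
  have hpre : (fun p : ℝ × (ℕ → ℝ) => consSeq p.1 p.2) ⁻¹'
      (Set.pi (Finset.range (N + 1) : Set ℕ) t')
      = t' 0 ×ˢ Set.pi (Finset.range N : Set ℕ) (fun i => t' (i + 1)) := by
    ext ⟨a, ω⟩
    simp only [mem_preimage, Set.mem_pi, Finset.coe_range, mem_Iio, mem_prod]
    refine ⟨fun h => ⟨h 0 (by omega), fun i hi => h (i + 1) (by omega)⟩, fun h i hi => ?_⟩
    cases i with
    | zero => exact h.1
    | succ i => exact h.2 i (by omega)
  rw [hpi, hprod, Measure.map_apply measurable_consSeq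
    (MeasurableSet.pi (Finset.countable_toSet _) fun i _ => hm i), hpre, Measure.prod_prod,
    clockLaw_pi hlam _ fun i => hm (i + 1), Finset.prod_range_succ', mul_comm]

lemma ae_clockLaw_nonneg (hlam : 0 < lam) : ∀ᵐ ω ∂clockLaw lam, ∀ i, 0 ≤ ω i := by
  have := isProbabilityMeasure_expMeasure hlam
  exact ae_all_iff.2 fun i =>
    (measurePreserving_eval_infinitePi (fun _ : ℕ => expMeasure lam) i).quasiMeasurePreserving.ae
      (ae_nonneg_expMeasure lam)

lemma measurable_jumpTime (k : ℕ) : Measurable (fun ω : ℕ → ℝ => jumpTime ω k) := by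
  unfold jumpTime; fun_prop

lemma jumpTime_mono {ω : ℕ → ℝ} (hω : ∀ i, 0 ≤ ω i) : Monotone (jumpTime ω) :=
  monotone_nat_of_le_succ fun k => by
    rw [jumpTime, jumpTime, Finset.sum_range_succ]; linarith [hω k]

lemma jumpTime_consSeq (a : ℝ) (ω : ℕ → ℝ) (k : ℕ) :
    jumpTime (consSeq a ω) (k + 1) = a + jumpTime ω k := by
  rw [jumpTime, Finset.sum_range_succ', add_comm]; rfl

lemma jumpCount_eq_zero {ω : ℕ → ℝ} {t : ℝ} (h : t < ω 0) : jumpCount ω t = 0 :=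
  Nat.sInf_eq_zero.2 (.inl (by simpa [jumpTime] using h))

lemma jumpCount_eq_one {ω : ℕ → ℝ} {t : ℝ} (h0 : ω 0 ≤ t) (h1 : t < ω 0 + ω 1) :
    jumpCount ω t = 1 := by
  have hmem : (1 : ℕ) ∈ {k : ℕ | t < jumpTime ω (k + 1)} := by
    simpa [jumpTime, Finset.sum_range_succ] using h1
  have hle : jumpCount ω t ≤ 1 := Nat.sInf_le hmem
  have hne : jumpCount ω t ≠ 0 := by
    intro h
    have := Nat.sInf_mem ⟨1, hmem⟩
    rw [← jumpCount, h] at this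
    simp [jumpTime] at this
    linarith
  omega

lemma jumpTime_le_of_lt_jumpCount {ω : ℕ → ℝ} {t : ℝ} {k : ℕ} (hk : k < jumpCount ω t) :
    jumpTime ω (k + 1) ≤ t := by
  have := Nat.notMem_of_lt_sInf hk
  simpa using this

lemma jumpTime_jumpCount_le {ω : ℕ → ℝ} {t : ℝ} (ht : 0 ≤ t) :
    jumpTime ω (jumpCount ω t) ≤ t := by
  rcases h : jumpCount ω t with _ | k
  · simpa [jumpTime] using ht
  · exact jumpTime_le_of_lt_jumpCount (by omega)

/-- The second alternative for `n = 0` is the convention `sInf ∅ = 0`, when all jumps occur by time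
`t`. -/
lemma jumpCount_eq_iff {ω : ℕ → ℝ} {t : ℝ} {n : ℕ} : jumpCount ω t = n ↔
    (∀ k < n, jumpTime ω (k + 1) ≤ t) ∧
      (t < jumpTime ω (n + 1) ∨ (n = 0 ∧ ∀ k, jumpTime ω (k + 1) ≤ t)) := by
  constructor
  · rintro rfl
    refine ⟨fun k hk => jumpTime_le_of_lt_jumpCount hk, ?_⟩
    by_cases h : {k : ℕ | t < jumpTime ω (k + 1)}.Nonempty
    · exact .inl (Nat.sInf_mem h)
    · have h' := not_nonempty_iff_eq_empty.1 h
      refine .inr ⟨by rw [jumpCount, h', Nat.sInf_empty], fun k => ?_⟩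
      by_contra! hk
      exact h ⟨k, hk⟩
  · rintro ⟨h1, h2 | ⟨rfl, h2⟩⟩
    · refine le_antisymm (Nat.sInf_le h2) ?_
      by_contra! hlt
      exact absurd (Nat.sInf_mem (s := {k : ℕ | t < jumpTime ω (k + 1)}) ⟨n, h2⟩)
        (not_lt.2 (h1 _ hlt))
    · refine Nat.sInf_eq_zero.2 (.inr (eq_empty_iff_forall_notMem.2 fun k hk => ?_))
      exact absurd hk (not_lt.2 (h2 k))

lemma measurable_jumpCount (t : ℝ) : Measurable (fun ω : ℕ → ℝ => jumpCount ω t) := by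
  refine measurable_to_countable' fun n => ?_
  have : (fun ω : ℕ → ℝ => jumpCount ω t) ⁻¹' {n} =
      {ω | (∀ k < n, jumpTime ω (k + 1) ≤ t) ∧
      (t < jumpTime ω (n + 1) ∨ (n = 0 ∧ ∀ k, jumpTime ω (k + 1) ≤ t))} := by
    ext ω; exact jumpCount_eq_iff
  rw [this]
  have h1 : ∀ k, MeasurableSet {ω : ℕ → ℝ | jumpTime ω (k + 1) ≤ t} := fun k =>
    measurableSet_le (measurable_jumpTime _) measurable_const
  refine MeasurableSet.inter ?_ (MeasurableSet.union
    (measurableSet_lt measurable_const (measurable_jumpTime _))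
    (MeasurableSet.inter (MeasurableSet.const _) ?_))
  · exact (MeasurableSet.iInter fun k => MeasurableSet.iInter fun (_ : k < n) => h1 k).congr
      (by ext; simp; rfl)
  · exact (MeasurableSet.iInter h1).congr (by ext; simp; rfl)

/-- Non-explosion: almost surely some clock exceeds `t`, and one is enough. -/
lemma ae_exists_lt_jumpTime (hlam : 0 < lam) {t : ℝ} (ht : 0 ≤ t) :
    ∀ᵐ ω ∂clockLaw lam, ∃ k, t < jumpTime ω (k + 1) := by
  have := isProbabilityMeasure_expMeasure hlam
  have h0 : clockLaw lam {ω | ∀ i, ω i ≤ t} = 0 := by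
    refine le_antisymm ?_ zero_le
    have hlim : Tendsto (fun n : ℕ => expMeasure lam (Iic t) ^ n) atTop (𝓝 0) := by
      refine ENNReal.tendsto_pow_atTop_nhds_zero_of_lt_one ?_
      rw [← ofReal_measureReal, expMeasure_Iic hlam ht, ← ENNReal.ofReal_one]
      exact ENNReal.ofReal_lt_ofReal_iff one_pos |>.2 (by linarith [Real.exp_pos (-(lam * t))])
    refine ge_of_tendsto' hlim fun n => ?_
    have := clockLaw_pi hlam (Finset.range n) (t := fun _ => Iic t) fun _ => measurableSet_Iic
    rw [Finset.prod_const, Finset.card_range] at this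
    rw [← this]
    exact measure_mono fun ω hω i _ => hω i
  have h1 : ∀ᵐ ω ∂clockLaw lam, ¬ ∀ i, ω i ≤ t := by
    rw [ae_iff]; simpa using h0
  filter_upwards [h1, ae_clockLaw_nonneg hlam] with ω h hω
  push Not at h
  obtain ⟨i, hi⟩ := h
  refine ⟨i, hi.trans_le ?_⟩
  have := jumpTime_mono hω (Nat.zero_le i)
  rw [jumpTime, Finset.sum_range_succ]
  simp [jumpTime] at this
  linarith

end Clock

/-! ### The process as a random affine map; generating function of the jump count. -/

section JumpProcess

variable {lam δ t : ℝ}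

lemma embeddedChain_eq (δ x : ℝ) (ω : ℕ → ℝ) (k : ℕ) :
    embeddedChain δ x ω k = δ ^ k * x + embeddedChain δ 0 ω k := by
  induction k with
  | zero => simp [embeddedChain]
  | succ k ih => rw [embeddedChain, ih, embeddedChain]; ring

/-- The flow is a translation and each jump a multiplication by `δ`, so the semigroup is an
`affineMean`. -/
lemma process_eq (δ x t : ℝ) (ω : ℕ → ℝ) :
    process δ x t ω = δ ^ jumpCount ω t * x + process δ 0 t ω := by
  rw [process, embeddedChain_eq, process]; ring

lemma embeddedChain_nonneg (hδ0 : 0 ≤ δ) {ω : ℕ → ℝ} (hω : ∀ i, 0 ≤ ω i) (k : ℕ) :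
    0 ≤ embeddedChain δ 0 ω k := by
  induction k with
  | zero => simp [embeddedChain]
  | succ k ih => rw [embeddedChain]; have := hω k; positivity

lemma embeddedChain_le_jumpTime (hδ0 : 0 ≤ δ) (hδ1 : δ < 1) {ω : ℕ → ℝ} (hω : ∀ i, 0 ≤ ω i)
    (k : ℕ) : embeddedChain δ 0 ω k ≤ jumpTime ω k := by
  induction k with
  | zero => simp [embeddedChain, jumpTime]
  | succ k ih =>
    rw [embeddedChain, jumpTime, Finset.sum_range_succ, ← jumpTime]
    have h1 := embeddedChain_nonneg hδ0 hω k
    have h2 := mul_le_of_le_one_left (add_nonneg h1 (hω k)) hδ1.le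
    linarith

lemma process_zero_nonneg (hδ0 : 0 ≤ δ) (ht : 0 ≤ t) {ω : ℕ → ℝ} (hω : ∀ i, 0 ≤ ω i) :
    0 ≤ process δ 0 t ω :=
  add_nonneg (embeddedChain_nonneg hδ0 hω _) (sub_nonneg.2 (jumpTime_jumpCount_le ht))

lemma process_zero_le (hδ0 : 0 ≤ δ) (hδ1 : δ < 1) {ω : ℕ → ℝ} (hω : ∀ i, 0 ≤ ω i) :
    process δ 0 t ω ≤ t := by
  have := embeddedChain_le_jumpTime hδ0 hδ1 hω (jumpCount ω t)
  rw [process]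
  linarith

lemma process_nonneg (hδ0 : 0 ≤ δ) (ht : 0 ≤ t) {x : ℝ} (hx : 0 ≤ x) {ω : ℕ → ℝ}
    (hω : ∀ i, 0 ≤ ω i) : 0 ≤ process δ x t ω := by
  rw [process_eq]
  have := process_zero_nonneg hδ0 ht hω
  positivity

lemma measurable_embeddedChain (δ x : ℝ) (k : ℕ) :
    Measurable (fun ω : ℕ → ℝ => embeddedChain δ x ω k) := by
  induction k with
  | zero => exact measurable_const
  | succ k ih => exact (ih.add (measurable_pi_apply k)).const_mul δ

lemma measurable_process (δ x t : ℝ) : Measurable (process δ x t) := by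
  have h : Measurable (fun p : ℕ × (ℕ → ℝ) => embeddedChain δ x p.2 p.1
      + (t - jumpTime p.2 p.1)) :=
    measurable_from_prod_countable_right fun k =>
      (measurable_embeddedChain δ x k).add ((measurable_jumpTime k).const_sub t)
  exact h.comp ((measurable_jumpCount t).prodMk measurable_id)

lemma measurable_pow_jumpCount (a t : ℝ) : Measurable (fun ω : ℕ → ℝ => a ^ jumpCount ω t) :=
  (measurable_from_top (f := fun k : ℕ => a ^ k)).comp (measurable_jumpCount t)

lemma isAffineContraction_process (hlam : 0 < lam) (hδ0 : 0 ≤ δ) (hδ1 : δ < 1) (ht : 0 ≤ t) :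
    IsAffineContraction (clockLaw lam) (fun ω => δ ^ jumpCount ω t) (process δ 0 t) where
  measurable_coeff := measurable_pow_jumpCount δ t
  measurable_shift := measurable_process δ 0 t
  coeff_nonneg _ := by positivity
  coeff_le_one _ := pow_le_one₀ hδ0 hδ1.le
  integrable_shift k := by
    have := isProbabilityMeasure_clockLaw hlam
    have := measurable_process δ 0 t
    refine Integrable.of_bound (C := (1 + t) ^ k) (Measurable.aestronglyMeasurable (by fun_prop)) ?_
    filter_upwards [ae_clockLaw_nonneg hlam] with ω hω
    rw [Real.norm_of_nonneg (by positivity), abs_of_nonneg (process_zero_nonneg hδ0 ht hω)]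
    have := process_zero_nonneg hδ0 ht hω
    have := process_zero_le (t := t) hδ0 hδ1 hω
    gcongr

lemma IsInvariantLaw.isStationary {μ : Measure ℝ} (hlam : 0 < lam) (hμ : IsInvariantLaw lam δ μ)
    (ht : 0 ≤ t) :
    IsStationary μ (clockLaw lam) (fun ω => δ ^ jumpCount ω t) (process δ 0 t) := by
  have := isProbabilityMeasure_clockLaw hlam
  refine Measure.ext fun s hs => ?_
  have hm : Measurable (fun p : ℝ × (ℕ → ℝ) =>
      δ ^ jumpCount p.2 t * p.1 + process δ 0 t p.2) :=
    ((measurable_pow_jumpCount δ t).comp measurable_snd |>.mul measurable_fst).add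
      ((measurable_process δ 0 t).comp measurable_snd)
  rw [Measure.map_apply hm hs, Measure.prod_apply (hm hs), ← hμ.invariant t ht s hs]
  refine lintegral_congr fun x => ?_
  congr 1 with ω
  change δ ^ jumpCount ω t * x + process δ 0 t ω ∈ s ↔ process δ x t ω ∈ s
  rw [← process_eq]

/-- The number of indices `k < n` such that the `(k + 1)`-st jump occurs before time `t`. -/
noncomputable def jumpCountBelow (n : ℕ) (t : ℝ) (ω : ℕ → ℝ) : ℕ :=
  ∑ k ∈ Finset.range n, if jumpTime ω (k + 1) ≤ t then 1 else 0

lemma measurable_pow_jumpCountBelow (a : ℝ) (n : ℕ) (t : ℝ) :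
    Measurable (fun ω => a ^ jumpCountBelow n t ω) := by
  have h : Measurable (jumpCountBelow n t) :=
    Finset.measurable_sum _ fun k _ => Measurable.ite
      (measurableSet_le (measurable_jumpTime _) measurable_const) measurable_const measurable_const
  exact (measurable_from_top (f := fun k : ℕ => a ^ k)).comp h

lemma jumpCountBelow_le_jumpCount {n : ℕ} {ω : ℕ → ℝ} (hω : ∀ i, 0 ≤ ω i)
    (h : ∃ k, t < jumpTime ω (k + 1)) : jumpCountBelow n t ω ≤ jumpCount ω t := by
  rw [jumpCountBelow, ← Finset.card_filter]
  refine (Finset.card_le_card (t := Finset.range (jumpCount ω t)) fun k hk => ?_).trans_eq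
    (Finset.card_range _)
  rw [Finset.mem_filter] at hk
  rw [Finset.mem_range]
  by_contra! hle
  have h1 : t < jumpTime ω (jumpCount ω t + 1) :=
    Nat.sInf_mem (s := {k : ℕ | t < jumpTime ω (k + 1)}) h
  have h2 := jumpTime_mono hω (Nat.succ_le_succ hle)
  exact absurd (h1.trans_le h2) (not_lt.2 hk.2)

lemma jumpCountBelow_consSeq {n : ℕ} {b : ℝ} {ω : ℕ → ℝ} (hb : b ≤ t) :
    jumpCountBelow (n + 1) t (consSeq b ω) = jumpCountBelow n (t - b) ω + 1 := by
  rw [jumpCountBelow, Finset.sum_range_succ', jumpCountBelow]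
  simp only [jumpTime_consSeq, ← le_sub_iff_add_le']
  simp [jumpTime, hb]

lemma integrable_exp_first_jump (hlam : 0 < lam) (a : ℝ) :
    Integrable (fun b => if b ≤ t then a * Real.exp (-(lam * (1 - a) * (t - b))) else 1)
      (expMeasure lam) := by
  have := isProbabilityMeasure_expMeasure hlam
  refine Integrable.of_bound
    (C := 1 + |a| * Real.exp (lam * |1 - a| * t)) (Measurable.aestronglyMeasurable
      (Measurable.ite measurableSet_Iic (by fun_prop) measurable_const)) ?_
  filter_upwards [ae_nonneg_expMeasure lam] with b hb
  split_ifs with h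
  · rw [norm_mul, Real.norm_eq_abs, Real.norm_of_nonneg (Real.exp_pos _).le]
    have h1 : -(lam * (1 - a) * (t - b)) ≤ lam * |1 - a| * t := by
      have h2 : -(1 - a) ≤ |1 - a| := neg_le_abs _
      have h3 : -(1 - a) * (t - b) ≤ |1 - a| * t := by
        calc _ ≤ |1 - a| * (t - b) := mul_le_mul_of_nonneg_right h2 (by linarith)
          _ ≤ _ := by gcongr; linarith
      nlinarith
    have h4 := mul_le_mul_of_nonneg_left (Real.exp_le_exp.2 h1) (abs_nonneg a)
    linarith
  · rw [norm_one]
    have : 0 ≤ |a| * Real.exp (lam * |1 - a| * t) := by positivity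
    linarith

/-- The exponential solves the renewal equation of `𝔼 [a ^ N_t]` obtained by conditioning on the
first jump time `b`. -/
lemma integral_exp_first_jump (hlam : 0 < lam) (a : ℝ) (ht : 0 ≤ t) :
    ∫ b, (if b ≤ t then a * Real.exp (-(lam * (1 - a) * (t - b))) else 1) ∂expMeasure lam
      = Real.exp (-(lam * (1 - a) * t)) := by
  have := isProbabilityMeasure_expMeasure hlam
  have hi := integrable_exp_first_jump (t := t) hlam a
  have h1 := setIntegral_congr_fun (μ := expMeasure lam) (measurableSet_Iic (a := t))
    (f := fun b => if b ≤ t then a * Real.exp (-(lam * (1 - a) * (t - b))) else 1)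
    (g := fun b => a * Real.exp (-(lam * (1 - a) * (t - b)))) (fun b hb => if_pos hb)
  have h2 := setIntegral_congr_fun (μ := expMeasure lam) (measurableSet_Iic (a := t)).compl
    (f := fun b => if b ≤ t then a * Real.exp (-(lam * (1 - a) * (t - b))) else 1)
    (g := fun b => (1 : ℝ)) (fun b hb => if_neg hb)
  rw [← integral_add_compl (measurableSet_Iic (a := t)) hi, h1, h2,
    setIntegral_const, probReal_compl_eq_one_sub measurableSet_Iic, expMeasure_Iic hlam ht,
    ← integral_indicator measurableSet_Iic, integral_expMeasure hlam]
  have h3 : ∀ b, (lam * Real.exp (-(lam * b))) •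
      (Iic t).indicator (fun b => a * Real.exp (-(lam * (1 - a) * (t - b)))) b
      = (Iic t).indicator (fun b => Real.exp (-(lam * (1 - a) * t)) *
        (lam * a * Real.exp (-(lam * a * b)))) b := by
    intro b
    by_cases hb : b ≤ t
    · have : Real.exp (-(lam * b)) * Real.exp (-(lam * (1 - a) * (t - b)))
          = Real.exp (-(lam * (1 - a) * t)) * Real.exp (-(lam * a * b)) := by
        rw [← Real.exp_add, ← Real.exp_add]; congr 1; ring
      simp only [indicator, mem_Iic, hb, if_true, smul_eq_mul]
      linear_combination lam * a * this
    · simp [indicator, hb]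
  simp_rw [h3]
  rw [setIntegral_indicator measurableSet_Iic, Ioi_inter_Iic, integral_const_mul,
    ← intervalIntegral.integral_of_le ht,
    intervalIntegral.integral_eq_sub_of_hasDerivAt (f := fun b => -Real.exp (-(lam * a * b)))
      (fun b _ => ?_) (Continuous.intervalIntegrable (by fun_prop) _ _)]
  · have : Real.exp (-(lam * (1 - a) * t)) * Real.exp (-(lam * a * t)) = Real.exp (-(lam * t)) := by
      rw [← Real.exp_add]; congr 1; ring
    simp only [mul_zero, neg_zero, Real.exp_zero, smul_eq_mul]
    linear_combination -this
  · have h4 : HasDerivAt (fun b : ℝ => -(lam * a * b)) (-(lam * a * 1)) b :=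
      ((hasDerivAt_id b).const_mul _).neg
    convert! h4.exp.neg using 1
    ring

/-- Truncating the count allows induction on `n` through the first jump: the exponential term
reproduces itself and the error `a ^ n` gains a factor `a`. Thus the Poisson law of the count need
not be identified. -/
lemma integral_pow_jumpCountBelow_le (hlam : 0 < lam) {a : ℝ} (ha0 : 0 ≤ a) (ha1 : a < 1)
    (n : ℕ) : ∀ t : ℝ, 0 ≤ t → ∫ ω, a ^ jumpCountBelow n t ω ∂clockLaw lam
      ≤ Real.exp (-(lam * (1 - a) * t)) + a ^ n := by
  have := isProbabilityMeasure_expMeasure hlam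
  have := isProbabilityMeasure_clockLaw hlam
  induction n with
  | zero =>
    intro t _
    simp [jumpCountBelow, (Real.exp_pos _).le]
  | succ n ih =>
    intro t ht
    have hmt := measurable_pow_jumpCountBelow a (n + 1) t
    have hbd : ∀ m s ω, ‖a ^ jumpCountBelow m s ω‖ ≤ 1 := fun m s ω => by
      rw [Real.norm_of_nonneg (by positivity)]
      exact pow_le_one₀ ha0 ha1.le
    have hi : Integrable (fun p : ℝ × (ℕ → ℝ) => a ^ jumpCountBelow (n + 1) t (consSeq p.1 p.2))
        ((expMeasure lam).prod (clockLaw lam)) :=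
      Integrable.of_bound (C := 1) (hmt.comp measurable_consSeq).aestronglyMeasurable
        (ae_of_all _ fun p => hbd _ _ _)
    have hinner : ∀ b, Integrable (fun ω => a ^ jumpCountBelow (n + 1) t (consSeq b ω))
        (clockLaw lam) := fun b => Integrable.of_bound (C := 1)
      (hmt.comp (measurable_consSeq.comp (measurable_const.prodMk measurable_id))).aestronglyMeasurable
      (ae_of_all _ fun p => hbd _ _ _)
    rw [← map_consSeq_clockLaw hlam,
      integral_map measurable_consSeq.aemeasurable hmt.aestronglyMeasurable, integral_prod _ hi,
      ← integral_exp_first_jump hlam a ht]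
    have hc : ∫ _, a ^ (n + 1) ∂expMeasure lam = a ^ (n + 1) := by simp
    rw [← hc, ← integral_add (integrable_exp_first_jump hlam a) (integrable_const _)]
    refine integral_mono_ae hi.integral_prod_left
      ((integrable_exp_first_jump hlam a).add (integrable_const _)) ?_
    filter_upwards [ae_nonneg_expMeasure lam] with b hb
    split_ifs with h
    · simp only [jumpCountBelow_consSeq h, pow_succ']
      rw [integral_const_mul, ← mul_add]
      exact mul_le_mul_of_nonneg_left (ih (t - b) (by linarith)) ha0
    · refine (integral_mono (hinner b) (integrable_const (1 : ℝ))
        fun ω => pow_le_one₀ ha0 ha1.le).trans ?_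
      simp only [integral_const, probReal_univ, smul_eq_mul, mul_one]
      linarith [pow_nonneg ha0 (n + 1)]

lemma integral_pow_jumpCount_le (hlam : 0 < lam) {a : ℝ} (ha0 : 0 ≤ a) (ha1 : a < 1)
    (ht : 0 ≤ t) : ∫ ω, a ^ jumpCount ω t ∂clockLaw lam ≤ Real.exp (-(lam * (1 - a) * t)) := by
  have := isProbabilityMeasure_clockLaw hlam
  have hlim : Tendsto (fun n : ℕ => Real.exp (-(lam * (1 - a) * t)) + a ^ n) atTop
      (𝓝 (Real.exp (-(lam * (1 - a) * t)) + 0)) :=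
    (tendsto_pow_atTop_nhds_zero_of_lt_one ha0 ha1).const_add _
  rw [add_zero] at hlim
  refine ge_of_tendsto' hlim fun n => le_trans ?_
    (integral_pow_jumpCountBelow_le hlam ha0 ha1 n t ht)
  have hbd : ∀ k : ℕ, ‖a ^ k‖ ≤ 1 := fun k => by
    rw [Real.norm_of_nonneg (by positivity)]
    exact pow_le_one₀ ha0 ha1.le
  refine integral_mono_ae
    (Integrable.of_bound (C := 1) (measurable_pow_jumpCount a t).aestronglyMeasurable
      (ae_of_all _ fun _ => hbd _))
    (Integrable.of_bound (C := 1) (measurable_pow_jumpCountBelow a n t).aestronglyMeasurable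
      (ae_of_all _ fun _ => hbd _)) ?_
  filter_upwards [ae_clockLaw_nonneg hlam, ae_exists_lt_jumpTime hlam ht] with ω hω h
  exact pow_le_pow_of_le_one ha0 ha1.le (jumpCountBelow_le_jumpCount hω h)

end JumpProcess

/-! ### From invariance to the fixed-point equation. -/

section FixedPoint

variable {lam δ : ℝ} {μ : Measure ℝ}

lemma norm_cexp_sub_cexp_le (θ x y : ℝ) :
    ‖Complex.exp (θ * x * Complex.I) - Complex.exp (θ * y * Complex.I)‖ ≤ |θ| * |x - y| := by
  have h1 : Complex.exp (θ * x * Complex.I) - Complex.exp (θ * y * Complex.I)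
      = Complex.exp ((θ * y : ℝ) * Complex.I) *
        (Complex.exp (Complex.I * (θ * (x - y) : ℝ)) - 1) := by
    rw [mul_sub, ← Complex.exp_add, mul_one]
    push_cast
    congr 2; ring
  rw [h1, norm_mul, Complex.norm_exp_ofReal_mul_I, one_mul]
  refine Real.norm_exp_I_mul_ofReal_sub_one_le.trans_eq ?_
  rw [Real.norm_eq_abs, abs_mul]

lemma norm_cexp_le_one (θ x : ℝ) : ‖Complex.exp (θ * x * Complex.I)‖ ≤ 1 := by
  have := Complex.norm_exp_ofReal_mul_I (θ * x)
  push_cast at this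
  exact this.le

lemma clockLaw_first_le (hlam : 0 < lam) {t : ℝ} (ht : 0 ≤ t) :
    (clockLaw lam).real {ω | ω 0 ≤ t} = 1 - Real.exp (-(lam * t)) := by
  have h := clockLaw_pi hlam {0} (t := fun _ => Iic t) fun _ => measurableSet_Iic
  have h2 : Set.pi (({0} : Finset ℕ) : Set ℕ) (fun _ => Iic t) = {ω : ℕ → ℝ | ω 0 ≤ t} := by
    ext ω; simp
  rw [Finset.prod_singleton, h2] at h
  rw [measureReal_def, h, ← measureReal_def, expMeasure_Iic hlam ht]

lemma clockLaw_first_two_le (hlam : 0 < lam) {t : ℝ} (ht : 0 ≤ t) :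
    (clockLaw lam).real {ω | ω 0 ≤ t ∧ ω 1 ≤ t} = (1 - Real.exp (-(lam * t))) ^ 2 := by
  have h := clockLaw_pi hlam {0, 1} (t := fun _ => Iic t) fun _ => measurableSet_Iic
  have h2 : Set.pi (({0, 1} : Finset ℕ) : Set ℕ) (fun _ => Iic t)
      = {ω : ℕ → ℝ | ω 0 ≤ t ∧ ω 1 ≤ t} := by
    ext ω; simp
  rw [Finset.prod_pair (by norm_num), h2] at h
  rw [measureReal_def, h, ENNReal.toReal_mul, ← measureReal_def, expMeasure_Iic hlam ht, pow_two]

/-- The short-time expansion of the semigroup on characters. -/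
lemma norm_integral_cexp_process_sub_le (hlam : 0 < lam) (hδ0 : 0 ≤ δ) (hδ1 : δ < 1) {t : ℝ}
    (ht : 0 ≤ t) (θ x : ℝ) :
    ‖∫ ω, Complex.exp (θ * process δ x t ω * Complex.I) ∂clockLaw lam
      - (Real.exp (-(lam * t)) * Complex.exp (θ * (x + t : ℝ) * Complex.I)
        + (1 - Real.exp (-(lam * t)) : ℝ) * Complex.exp (θ * (δ * x : ℝ) * Complex.I))‖
      ≤ (|θ| * lam + 2 * lam ^ 2) * t ^ 2 := by
  have := isProbabilityMeasure_clockLaw hlam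
  -- Off `p` there is no jump and the position is `x + t`. On `p` outside `q` there is exactly one,
  -- and the position is within `t` of `δ x`. On `q`, of probability at most `(lam t) ^ 2`, the
  -- trivial bound `2` suffices.
  set p : Set (ℕ → ℝ) := {ω | ω 0 ≤ t}
  set q : Set (ℕ → ℝ) := {ω | ω 0 ≤ t ∧ ω 1 ≤ t}
  have mp : MeasurableSet p := measurableSet_le (measurable_pi_apply 0) measurable_const
  have mq : MeasurableSet q :=
    mp.inter (measurableSet_le (measurable_pi_apply 1) measurable_const)
  set u := Complex.exp (θ * (x + t : ℝ) * Complex.I)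
  set v := Complex.exp (θ * (δ * x : ℝ) * Complex.I)
  have i1 : Integrable (fun ω => Complex.exp (θ * process δ x t ω * Complex.I)) (clockLaw lam) := by
    have := measurable_process δ x t
    exact Integrable.of_bound (C := 1) (Measurable.aestronglyMeasurable (by fun_prop))
      (ae_of_all _ fun ω => norm_cexp_le_one _ _)
  have i2 : Integrable (pᶜ.indicator fun _ => u) (clockLaw lam) :=
    (integrable_const u).indicator mp.compl
  have i3 : Integrable (p.indicator fun _ => v) (clockLaw lam) :=
    (integrable_const v).indicator mp
  have i4 : Integrable (p.indicator fun _ => |θ| * t) (clockLaw lam) :=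
    (integrable_const _).indicator mp
  have i5 : Integrable (q.indicator fun _ => (2 : ℝ)) (clockLaw lam) :=
    (integrable_const _).indicator mq
  have e1 : ∫ ω, (pᶜ.indicator (fun _ => u) ω + p.indicator (fun _ => v) ω) ∂clockLaw lam
      = Real.exp (-(lam * t)) * u + (1 - Real.exp (-(lam * t)) : ℝ) * v := by
    rw [integral_add i2 i3, integral_indicator mp.compl, integral_indicator mp, setIntegral_const,
      setIntegral_const, probReal_compl_eq_one_sub mp, clockLaw_first_le hlam ht]
    simp
  have e2 : ∫ ω, (p.indicator (fun _ => |θ| * t) ω + q.indicator (fun _ => (2 : ℝ)) ω)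
      ∂clockLaw lam = (1 - Real.exp (-(lam * t))) * (|θ| * t)
        + (1 - Real.exp (-(lam * t))) ^ 2 * 2 := by
    rw [integral_add i4 i5, integral_indicator mp, integral_indicator mq, setIntegral_const,
      setIntegral_const, clockLaw_first_le hlam ht, clockLaw_first_two_le hlam ht]
    simp
  rw [← e1, ← integral_sub i1 (by exact i2.add i3)]
  refine (norm_integral_le_of_norm_le (i4.add i5) ?_).trans ?_
  · filter_upwards [ae_clockLaw_nonneg hlam] with ω hω
    simp only [Pi.add_apply]
    by_cases h0 : ω 0 ≤ t
    · have hωp : ω ∈ p := h0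
      rw [indicator_of_notMem (s := pᶜ) (by simpa using hωp), indicator_of_mem hωp,
        indicator_of_mem hωp, zero_add]
      by_cases h1 : ω 1 ≤ t
      · rw [indicator_of_mem (show ω ∈ q from ⟨h0, h1⟩)]
        have h2 := norm_sub_le (Complex.exp (θ * process δ x t ω * Complex.I)) v
        have h3 := norm_cexp_le_one θ (process δ x t ω)
        have h4 := norm_cexp_le_one θ (δ * x)
        have h5 : 0 ≤ |θ| * t := by positivity
        linarith
      · rw [indicator_of_notMem (s := q) (fun h => h1 h.2), add_zero]
        refine (norm_cexp_sub_cexp_le θ _ _).trans ?_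
        gcongr
        have h2 : process δ x t ω - δ * x = δ * ω 0 + (t - ω 0) := by
          rw [process, jumpCount_eq_one h0 (by linarith [hω 0])]
          simp [embeddedChain, jumpTime]
          ring
        have h3 := mul_nonneg hδ0 (hω 0)
        have h4 := mul_le_of_le_one_left (hω 0) hδ1.le
        rw [h2, abs_of_nonneg (by linarith)]
        linarith
    · have hωp : ω ∉ p := h0
      have hωq : ω ∉ q := fun h => h0 h.1
      have h2 : process δ x t ω = x + t := by
        rw [process, jumpCount_eq_zero (not_le.1 h0)]
        simp [embeddedChain, jumpTime]
      rw [indicator_of_mem (show ω ∈ pᶜ from hωp), indicator_of_notMem hωp,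
        indicator_of_notMem hωp, indicator_of_notMem hωq, h2]
      simp [u]
  · simp only [Pi.add_apply]
    rw [e2]
    have h1 : 1 - Real.exp (-(lam * t)) ≤ lam * t := by
      linarith [Real.add_one_le_exp (-(lam * t))]
    have h2 : 0 ≤ 1 - Real.exp (-(lam * t)) := by
      have : Real.exp (-(lam * t)) ≤ 1 := Real.exp_le_one_iff.2 (by
        have := mul_nonneg hlam.le ht
        linarith)
      linarith
    calc _ ≤ lam * t * (|θ| * t) + (lam * t) ^ 2 * 2 := by gcongr
      _ = _ := by ring

/-- The expansion on characters is uniform in `x`, so it integrates against `μ`; invariance turns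
the exact term into `charFun μ θ`. -/
lemma norm_charFun_sub_le (hlam : 0 < lam) (hδ0 : 0 ≤ δ) (hδ1 : δ < 1)
    (hμ : IsInvariantLaw lam δ μ) {t : ℝ} (ht : 0 ≤ t) (θ : ℝ) :
    ‖charFun μ θ - (Complex.exp ((θ * Complex.I - lam) * t) * charFun μ θ
      + (1 - Complex.exp (-lam * t)) * charFun μ (δ * θ))‖
      ≤ (|θ| * lam + 2 * lam ^ 2) * t ^ 2 := by
  have := isProbabilityMeasure_clockLaw hlam
  have := hμ.isProbabilityMeasure
  have hst := hμ.isStationary hlam ht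
  have hA := isAffineContraction_process hlam hδ0 hδ1 ht
  have hm : Measurable (fun p : ℝ × (ℕ → ℝ) =>
      δ ^ jumpCount p.2 t * p.1 + process δ 0 t p.2) :=
    ((measurable_pow_jumpCount δ t).comp measurable_snd |>.mul measurable_fst).add
      ((measurable_process δ 0 t).comp measurable_snd)
  have hbd : Integrable (fun p : ℝ × (ℕ → ℝ) => Complex.exp (θ *
      (δ ^ jumpCount p.2 t * p.1 + process δ 0 t p.2 : ℝ) * Complex.I))
      (μ.prod (clockLaw lam)) :=
    Integrable.of_bound (C := 1) (Measurable.aestronglyMeasurable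
      ((by fun_prop : Measurable fun y : ℝ => Complex.exp (θ * y * Complex.I)).comp hm))
      (ae_of_all _ fun p => norm_cexp_le_one _ _)
  have h1 : charFun μ θ
      = ∫ x, ∫ ω, Complex.exp (θ * process δ x t ω * Complex.I) ∂clockLaw lam ∂μ := by
    conv_lhs => rw [← hst]
    rw [charFun_apply_real, integral_map hm.aemeasurable
      (Measurable.aestronglyMeasurable (by fun_prop)), integral_prod _ hbd]
    simp only [← process_eq]
  have i1 : Integrable (fun x => ∫ ω, Complex.exp (θ * process δ x t ω * Complex.I)
      ∂clockLaw lam) μ := by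
    have := hbd.integral_prod_left
    simpa only [← process_eq] using this
  have hc : ∀ c d : ℝ, Integrable (fun x : ℝ => Complex.exp (θ * (c * x + d : ℝ) * Complex.I)) μ :=
    fun c d => Integrable.of_bound (C := 1) (Measurable.aestronglyMeasurable (by fun_prop))
      (ae_of_all _ fun x => norm_cexp_le_one _ _)
  have i2 : Integrable (fun x : ℝ => Complex.exp (θ * (x + t : ℝ) * Complex.I)) μ := by
    simpa only [one_mul] using hc 1 t
  have i3 : Integrable (fun x : ℝ => Complex.exp (θ * (δ * x : ℝ) * Complex.I)) μ := by
    simpa only [add_zero] using hc δ 0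
  have h2 : Complex.exp ((θ * Complex.I - lam) * t) * charFun μ θ
      + (1 - Complex.exp (-lam * t)) * charFun μ (δ * θ)
      = ∫ x : ℝ, (Real.exp (-(lam * t)) * Complex.exp (θ * (x + t : ℝ) * Complex.I)
        + (1 - Real.exp (-(lam * t)) : ℝ) * Complex.exp (θ * (δ * x : ℝ) * Complex.I)) ∂μ := by
    rw [integral_add (i2.const_mul _) (i3.const_mul _), charFun_apply_real, charFun_apply_real,
      ← integral_const_mul, ← integral_const_mul, integral_const_mul (Complex.ofReal _)]
    congr 1
    · rw [← integral_const_mul]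
      refine integral_congr_ae (ae_of_all _ fun x => ?_)
      simp only [Complex.ofReal_exp, ← Complex.exp_add]
      congr 1; push_cast; ring
    · rw [integral_const_mul, integral_const_mul]
      push_cast
      congr 1
      · ring_nf
      · refine integral_congr_ae (ae_of_all _ fun x => ?_)
        simp only
        congr 1; ring
  have i4 : Integrable (fun x : ℝ => (Real.exp (-(lam * t)) *
      Complex.exp (θ * (x + t : ℝ) * Complex.I)
        + (1 - Real.exp (-(lam * t)) : ℝ) * Complex.exp (θ * (δ * x : ℝ) * Complex.I) : ℂ)) μ :=
    (i2.const_mul _).add (i3.const_mul _)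
  rw [h2, h1, ← integral_sub i1 i4]
  refine (norm_integral_le_of_norm_le (integrable_const ((|θ| * lam + 2 * lam ^ 2) * t ^ 2))
    (ae_of_all _ fun x => norm_integral_cexp_process_sub_le hlam hδ0 hδ1 ht θ x)).trans_eq ?_
  simp

/-- The quantity `Φ t` is `O(t ^ 2)` as `t → 0` from the right, so its derivative at `0` vanishes;
this is the claimed identity. -/
lemma charFun_mul_eq (hlam : 0 < lam) (hδ0 : 0 ≤ δ) (hδ1 : δ < 1)
    (hμ : IsInvariantLaw lam δ μ) (θ : ℝ) :
    charFun μ θ * (lam - θ * Complex.I) = lam * charFun μ (δ * θ) := by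
  set Φ : ℝ → ℂ := fun t => charFun μ θ - (Complex.exp ((θ * Complex.I - lam) * t) * charFun μ θ
      + (1 - Complex.exp (-lam * t)) * charFun μ (δ * θ)) with hΦ
  have hexp : ∀ z : ℂ, HasDerivAt (fun t : ℝ => Complex.exp (z * t)) z 0 := by
    intro z
    have h := (((hasDerivAt_id (0 : ℝ)).ofReal_comp).const_mul z).cexp
    simpa using h
  have hd : HasDerivAt Φ (0 - (((θ * Complex.I - lam) * charFun μ θ)
      + (0 - (-lam : ℂ)) * charFun μ (δ * θ))) 0 :=
    (hasDerivAt_const _ _).sub (((hexp _).mul_const _).add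
      (((hasDerivAt_const _ _).sub (hexp _)).mul_const _))
  have hd0 : HasDerivWithinAt Φ 0 (Ici 0) 0 := by
    have hΦ0 : Φ 0 = 0 := by simp [hΦ]
    rw [hasDerivWithinAt_iff_isLittleO]
    simp only [hΦ0, sub_zero, smul_zero]
    refine Asymptotics.IsBigO.trans_isLittleO (g := fun t : ℝ => t ^ 2)
      (Asymptotics.IsBigO.of_bound (|θ| * lam + 2 * lam ^ 2) ?_)
      ((Asymptotics.isLittleO_pow_id one_lt_two).mono nhdsWithin_le_nhds)
    filter_upwards [self_mem_nhdsWithin] with t ht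
    rw [Real.norm_of_nonneg (sq_nonneg t)]
    exact norm_charFun_sub_le hlam hδ0 hδ1 hμ ht θ
  have := UniqueDiffWithinAt.eq_deriv _ (uniqueDiffOn_Ici (0 : ℝ) 0 self_mem_Ici)
    hd.hasDerivWithinAt hd0
  linear_combination this

/-- An invariant law of the process is the law of `δ X + E`, with `X` of that law and `E` an
independent exponential variable. -/
lemma IsInvariantLaw.isStationary_exp (hlam : 0 < lam) (hδ0 : 0 ≤ δ) (hδ1 : δ < 1)
    (hμ : IsInvariantLaw lam δ μ) : IsStationary μ (expMeasure lam) (fun _ => δ) id := by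
  have := isProbabilityMeasure_expMeasure hlam
  have := hμ.isProbabilityMeasure
  have hm : Measurable (fun p : ℝ × ℝ => δ * p.1 + id p.2) := by fun_prop
  have : IsProbabilityMeasure ((μ.prod (expMeasure lam)).map fun p => δ * p.1 + id p.2) :=
    Measure.isProbabilityMeasure_map hm.aemeasurable
  refine Measure.ext_of_charFun (funext fun θ => ?_)
  have hne : (lam : ℂ) - θ * Complex.I ≠ 0 := by
    intro h
    have := congrArg Complex.re h
    simp at this
    linarith
  refine mul_right_cancel₀ hne ?_
  rw [charFun_mul_eq hlam hδ0 hδ1 hμ, charFun_apply_real, integral_map hm.aemeasurable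
    (Measurable.aestronglyMeasurable (by fun_prop))]
  have : ∀ p : ℝ × ℝ, Complex.exp (θ * (δ * p.1 + id p.2 : ℝ) * Complex.I)
      = Complex.exp ((δ * θ : ℝ) * p.1 * Complex.I) * Complex.exp (θ * p.2 * Complex.I) := by
    intro p
    rw [← Complex.exp_add]
    congr 1; push_cast [id]; ring
  simp_rw [this]
  rw [integral_prod_mul (fun x : ℝ => Complex.exp ((δ * θ : ℝ) * x * Complex.I))
    (fun x : ℝ => Complex.exp (θ * x * Complex.I)), ← charFun_apply_real, ← charFun_apply_real,
    mul_assoc, charFun_expMeasure hlam, mul_comm]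

end FixedPoint

/-! ### Extending test functions to the whole line. -/

section Extension

/-- The `C¹` extension of a function on `[0, ∞)` that is affine on the negative half-line. -/
noncomputable def affineExtension (f : ℝ → ℝ) (x : ℝ) : ℝ :=
  if 0 ≤ x then f x else f 0 + derivWithin f (Ici 0) 0 * x

lemma affineExtension_of_nonneg (f : ℝ → ℝ) {x : ℝ} (hx : 0 ≤ x) : affineExtension f x = f x :=
  if_pos hx

/-- At `0` the two one-sided derivatives agree and glue. -/
lemma hasDerivAt_affineExtension {f : ℝ → ℝ} (hf : DifferentiableOn ℝ f (Ici 0)) (x : ℝ) :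
    HasDerivAt (affineExtension f) (derivWithin f (Ici 0) (max x 0)) x := by
  have hr : ∀ y, 0 ≤ y →
      HasDerivWithinAt (affineExtension f) (derivWithin f (Ici 0) y) (Ici 0) y := fun y hy =>
    ((hf y hy).hasDerivWithinAt).congr (fun z hz => affineExtension_of_nonneg f hz)
      (affineExtension_of_nonneg f hy)
  have hl : ∀ y, y ≤ 0 →
      HasDerivWithinAt (affineExtension f) (derivWithin f (Ici 0) 0) (Iic 0) y := fun y hy => by
    have h : ∀ z ∈ Iic (0 : ℝ), affineExtension f z = f 0 + derivWithin f (Ici 0) 0 * z := by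
      intro z hz
      rcases (mem_Iic.1 hz).eq_or_lt with rfl | hz
      · simp [affineExtension]
      · exact if_neg (not_le.2 hz)
    have h1 := (((hasDerivAt_id y).const_mul (derivWithin f (Ici 0) 0)).const_add
      (f 0)).hasDerivWithinAt (s := Iic 0)
    rw [mul_one] at h1
    exact h1.congr h (h y hy)
  rcases lt_trichotomy x 0 with hx | rfl | hx
  · rw [max_eq_right hx.le]
    exact (hl x hx.le).hasDerivAt (Iic_mem_nhds hx)
  · rw [max_self]
    have := (hl 0 le_rfl).union (hr 0 le_rfl)
    rwa [Iic_union_Ici, hasDerivWithinAt_univ] at this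
  · rw [max_eq_left hx.le]
    exact (hr x hx.le).hasDerivAt (Ici_mem_nhds hx)

lemma deriv_affineExtension_of_nonneg {f : ℝ → ℝ} (hf : DifferentiableOn ℝ f (Ici 0)) {x : ℝ}
    (hx : 0 ≤ x) : deriv (affineExtension f) x = derivWithin f (Ici 0) x := by
  rw [(hasDerivAt_affineExtension hf x).deriv, max_eq_left hx]

lemma IsTestFunction.differentiableOn {f : ℝ → ℝ} (hf : IsTestFunction f) :
    DifferentiableOn ℝ f (Ici 0) := hf.1.differentiableOn (by simp)

/-- The growth bound on `f'` carries over because the derivative at `x` is that of `f` at `max x 0`.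
-/
lemma IsTestFunction.polySmooth {f : ℝ → ℝ} (hf : IsTestFunction f) :
    PolySmooth (affineExtension f) := by
  have hd := hf.differentiableOn
  refine ⟨fun x => (hasDerivAt_affineExtension hd x).differentiableAt, ?_⟩
  obtain ⟨C, k, hb⟩ := hf.2 1
  refine ⟨|C|, k, abs_nonneg _, fun x => ?_⟩
  have h := hb (max x 0) (mem_Ici.2 (le_max_right x 0))
  rw [iteratedDerivWithin_one] at h
  rw [(hasDerivAt_affineExtension hd x).deriv]
  have h0 : 0 ≤ max x 0 := le_max_right _ _
  calc _ ≤ C * (1 + max x 0) ^ k := h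
    _ ≤ |C| * (1 + max x 0) ^ k := by gcongr; exact le_abs_self C
    _ ≤ |C| * (1 + |x|) ^ k := by gcongr; exact max_le (le_abs_self x) (abs_nonneg x)

end Extension

lemma PolyBounded.memLp_two {g : ℝ → ℝ} (hg : PolyBounded g) (hm : Measurable g) {μ : Measure ℝ}
    (hμ : HasMoments μ) : MemLp g 2 μ :=
  (memLp_two_iff_integrable_sq hm.aestronglyMeasurable).2 (hg.sq.integrable hμ (by fun_prop))

end TCP

/-! ### The Poincaré inequality and the decay of the semigroup. -/

theorem proposition4p3 (lam δ : ℝ) (hlam : 0 < lam) (hδ0 : 0 ≤ δ) (hδ1 : δ < 1)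
    (μ : Measure ℝ) (hμ : TCP.IsInvariantLaw lam δ μ)
    (f : ℝ → ℝ) (hf : TCP.IsTestFunction f) :
    (MemLp f 2 μ ∧ MemLp (derivWithin f (Ici 0)) 2 μ ∧
      ∫ x, (f x - ∫ y, f y ∂μ) ^ 2 ∂μ
        ≤ 4 / (lam ^ 2 * (1 - δ ^ 2)) * ∫ x, (derivWithin f (Ici 0) x) ^ 2 ∂μ) ∧
    ∀ t : ℝ, 0 ≤ t →
      (∀ x : ℝ, 0 ≤ x → Integrable (fun ω => f (TCP.process δ x t ω)) (TCP.clockLaw lam)) ∧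
      MemLp (TCP.semigroup lam δ t f) 2 μ ∧
      ∫ x, (TCP.semigroup lam δ t f x - ∫ y, f y ∂μ) ^ 2 ∂μ
        ≤ 4 * Real.exp (-(lam * (1 - δ ^ 2) * t)) / (lam ^ 2 * (1 - δ ^ 2)) *
          ∫ x, (derivWithin f (Ici 0) x) ^ 2 ∂μ := by
  have := hμ.isProbabilityMeasure
  have := TCP.isProbabilityMeasure_clockLaw hlam
  have hpos : ∀ᵐ x ∂μ, 0 ≤ x := by
    filter_upwards [measure_eq_zero_iff_ae_notMem.1 hμ.support] with x hx using not_lt.1 hx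
  have hst := hμ.isStationary_exp hlam hδ0 hδ1
  have hmom := hst.hasMoments hlam hδ0 hδ1 hpos
  have hd := hf.differentiableOn
  -- As `μ` lives on `[0, ∞)`, replacing `f` by `F` changes no integral and allows calculus on `ℝ`.
  set F := TCP.affineExtension f
  have hFs : TCP.PolySmooth F := hf.polySmooth
  have hFm : Measurable F := hFs.differentiable.continuous.measurable
  have hfF : F =ᵐ[μ] f := by
    filter_upwards [hpos] with x hx using TCP.affineExtension_of_nonneg f hx
  have hfF' : deriv F =ᵐ[μ] derivWithin f (Ici 0) := by
    filter_upwards [hpos] with x hx using TCP.deriv_affineExtension_of_nonneg hd hx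
  have em : ∫ y, f y ∂μ = ∫ y, F y ∂μ := (integral_congr_ae hfF).symm
  have e1 : ∫ x, derivWithin f (Ici 0) x ^ 2 ∂μ = ∫ x, deriv F x ^ 2 ∂μ :=
    integral_congr_ae (hfF'.symm.fun_comp (· ^ 2))
  have hδ2 : 0 < 1 - δ ^ 2 := by nlinarith
  refine ⟨⟨(hFs.polyBounded.memLp_two hFm hmom).ae_eq hfF,
    (hFs.polyBounded_deriv.memLp_two (measurable_deriv F) hmom).ae_eq hfF', ?_⟩, fun t ht => ?_⟩
  · have e2 : ∫ x, (f x - ∫ y, F y ∂μ) ^ 2 ∂μ = ∫ x, (F x - ∫ y, F y ∂μ) ^ 2 ∂μ :=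
      integral_congr_ae (hfF.symm.fun_comp fun y => (y - ∫ y, F y ∂μ) ^ 2)
    rw [em, e1, e2]
    exact TCP.poincare_of_isStationary hlam hδ0 hδ1 hst hmom hFs
  have hA := TCP.isAffineContraction_process hlam hδ0 hδ1 ht
  have hstt := hμ.isStationary hlam ht
  set T := TCP.affineMean (TCP.clockLaw lam) (fun ω => δ ^ TCP.jumpCount ω t) (TCP.process δ 0 t) F
  have hTs : TCP.PolySmooth T := hA.polySmooth hFs
  have hproc : ∀ x, 0 ≤ x → (fun ω => F (δ ^ TCP.jumpCount ω t * x + TCP.process δ 0 t ω))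
      =ᵐ[TCP.clockLaw lam] fun ω => f (TCP.process δ x t ω) := fun x hx => by
    filter_upwards [TCP.ae_clockLaw_nonneg hlam] with ω hω
    rw [← TCP.process_eq]
    exact TCP.affineExtension_of_nonneg f (TCP.process_nonneg hδ0 ht hx hω)
  have hTf : T =ᵐ[μ] TCP.semigroup lam δ t f := by
    filter_upwards [hpos] with x hx using integral_congr_ae (hproc x hx)
  refine ⟨fun x hx => (hA.integrable_comp hFs.polyBounded hFm x).congr (hproc x hx),
    (hTs.polyBounded.memLp_two hTs.differentiable.continuous.measurable hmom).ae_eq hTf, ?_⟩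
  have h1 := TCP.poincare_of_isStationary hlam hδ0 hδ1 hst hmom hTs
  rw [hstt.integral_affineMean hA hmom hFs.polyBounded hFm] at h1
  have e2 : ∫ x, (TCP.semigroup lam δ t f x - ∫ y, F y ∂μ) ^ 2 ∂μ
      = ∫ x, (T x - ∫ y, F y ∂μ) ^ 2 ∂μ :=
    integral_congr_ae (hTf.symm.fun_comp fun y => (y - ∫ y, F y ∂μ) ^ 2)
  rw [em, e1, e2]
  refine h1.trans ?_
  have h2 := hstt.integral_sq_deriv_affineMean_le hA hmom hFs
  have h3 := TCP.integral_pow_jumpCount_le hlam (sq_nonneg δ) (by linarith : δ ^ 2 < 1) ht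
  -- The squared slope `(δ ^ N_t) ^ 2` and the generating function at `δ ^ 2` both become `δ ^ (2 *
  -- N_t)`.
  simp only [← pow_mul, mul_comm _ 2] at h2
  simp only [← pow_mul] at h3
  have h4 : 0 ≤ ∫ x, deriv F x ^ 2 ∂μ := integral_nonneg fun x => sq_nonneg _
  calc _ ≤ 4 / (lam ^ 2 * (1 - δ ^ 2)) *
        (Real.exp (-(lam * (1 - δ ^ 2) * t)) * ∫ x, deriv F x ^ 2 ∂μ) := by
        gcongr
        exact h2.trans (mul_le_mul_of_nonneg_right h3 h4)
    _ = _ := by ring
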